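/- Let $\lambda>0$, $\lambda_e\ge 0$, $0<p_i\le 1$, $D>0$, $\alpha>2$, $P>0$, $\gamma_e>0$, and put $\delta=2/\alpha$. Base stations (BSs) form a homogeneous Poisson point process $\Phi$ of density $\lambda$ in $\mathbb R^2$. Each BS $X\in\Phi$ carries independent marks, independent of $\Phi$ and of the marks of the other BSs: it holds file $i$ with probability $p_i$; its guard zone (the disk of radius $D$ around it) is free of eavesdroppers with probability $e^{-\lambda_e\pi D^2}$; and its channel to the origin has fading gain $h_X\sim\mathrm{Exp}(1)$. Let $\Phi_i^c$ be the BSs that do not hold file $i$, $\Phi_{ai}$ the BSs that hold it and have a free guard zone (the active BSs for file $i$), and $\Phi_{\bar ai}$ those that hold it and have a guard zone that is not free; their densities are $$\lambda_i^c=(1-p_i)\lambda,\qquad \lambda_{ai}=p_i\lambda e^{-\lambda_e\pi D^2},\qquad \lambda_{\bar ai}=p_i\lambda\bigl(1-e^{-\lambda_e\pi D^2}\bigr).$$ The typical eavesdropper is at the origin $o$. Let $\mathcal B(o,D)$ be the disk of radius $D$ centred at $o$, let $X_e=\arg\max_{X\in\Phi_{ai}\setminus\mathcal B(o,D)}P\|X\|^{-\alpha}$,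 and let $$I_e(i)=\sum_{X\in\Phi_i^c\cup\Phi_{\bar ai}}Ph_X\|X\|^{-\alpha}+\sum_{X\in\Phi_{ai}\setminus\mathcal B(o,D)\setminus\{X_e\}}Ph_X\|X\|^{-\alpha}+\sum_{X\in\Phi_{ai}\cap\mathcal B(o,D)}Ph_X\|X\|^{-\alpha}.$$ Almost surely $X_e$ exists and is unique, and $\|X_e\|$ has the density $f_{\|X_e\|}(r)=2\pi\lambda_{ai}r\,e^{-\pi\lambda_{ai}(r^2-D^2)}$ for $r>D$. The secrecy probability of file $i$ is $$\mathcal P_{si}=\mathbb P\left\{\frac{Ph_{X_e}\|X_e\|^{-\alpha}}{I_e(i)}<\gamma_e\right\}.$$ With $B$ the beta function and ${}_2F_1$ the Gauss hypergeometric function (analytically continued to arguments less than $1$), put $$\kappa_1(\gamma)=\delta\gamma^\delta B(1-\delta,\delta),\qquad \kappa_2(\gamma)=\frac{\delta\gamma}{1-\delta}\,{}_2F_1(1,1-\delta;2-\delta;-\gamma),$$ $$\tau_1(\gamma)=1+\kappa_2(\gamma)-\kappa_1(\gamma),\qquad \tau_2(\gamma)=\kappa_1(\gamma)e^{\pi\lambda_eD^2},$$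 $$\Theta(r)=-\pi\lambda_{ai}D^2\,{}_2F_1\Bigl(1,\delta;\delta+1;-\frac{D^\alpha}{\gamma_er^\alpha}\Bigr).$$ Then $$\mathcal P_{si}=1-\int_D^\infty\exp\Bigl(-\pi\bigl((\lambda_i^c+\lambda_{\bar ai})\kappa_1(\gamma_e)+\lambda_{ai}\kappa_2(\gamma_e)\bigr)r^2+\Theta(r)\Bigr)f_{\|X_e\|}(r)\,dr .$$ Replacing $\Theta(r)$ by $\Theta(D)$ turns the right-hand side into $$\mathcal P_{si}^L=1-\frac{\exp\left(-\pi D^2\kappa_1(\gamma_e)\lambda\right)}{\tau_1(\gamma_e)+\tau_2(\gamma_e)/p_i},$$ and $\mathcal P_{si}>\mathcal P_{si}^L$. (Both integrals converge absolutely.) -/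

import Mathlib

open MeasureTheory ProbabilityTheory

noncomputable section

namespace CacheSecrecy

/-! ### Special functions -/

/-- The Gauss hypergeometric function `₂F₁(a, b; c; x)` for real `0 < b < c` and `x < 1`, through
its Euler integral. This is the analytic continuation to `x < 1` of the hypergeometric series, which
converges only for `|x| < 1`. -/
def gaussHyp (a b c x : ℝ) : ℝ :=
  (beta b (c - b))⁻¹ *
    ∫ t in (0 : ℝ)..1, t ^ (b - 1) * (1 - t) ^ (c - b - 1) * (1 - x * t) ^ (-a)

theorem integrable_betaKernel {u v : ℝ} (hu : 0 < u) (hv : 0 < v) :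
    IntegrableOn (fun t : ℝ => t ^ (u - 1) * (1 - t) ^ (v - 1)) (Set.Ioc 0 1) := by
  have h := Complex.betaIntegral_convergent (u := u) (v := v) (by simpa) (by simpa)
  rw [intervalIntegrable_iff_integrableOn_Ioc_of_le zero_le_one] at h
  refine (IntegrableOn.congr_fun h.re (fun t ht => ?_) measurableSet_Ioc)
  have h1 : (0 : ℝ) ≤ 1 - t := by linarith [ht.2]
  simp only [RCLike.re_to_complex]
  norm_cast
  rw [← Complex.ofReal_cpow ht.1.le, ← Complex.ofReal_cpow h1]
  norm_cast

theorem integral_betaKernel {u v : ℝ} (hu : 0 < u) (hv : 0 < v) :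
    ∫ t in Set.Ioc (0 : ℝ) 1, t ^ (u - 1) * (1 - t) ^ (v - 1) = beta u v := by
  have h := Complex.betaIntegral_convergent (u := u) (v := v) (by simpa) (by simpa)
  rw [intervalIntegrable_iff_integrableOn_Ioc_of_le zero_le_one] at h
  rw [beta_eq_betaIntegralReal u v hu hv, Complex.betaIntegral,
    intervalIntegral.integral_of_le zero_le_one, ← RCLike.re_to_complex, ← integral_re h]
  refine setIntegral_congr_fun measurableSet_Ioc fun t ht => ?_
  have h1 : (0 : ℝ) ≤ 1 - t := by linarith [ht.2]
  simp only [RCLike.re_to_complex]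
  norm_cast
  rw [← Complex.ofReal_cpow ht.1.le, ← Complex.ofReal_cpow h1]
  norm_cast

theorem gamma_add_nat {u : ℝ} (hu : 0 < u) (n : ℕ) :
    Real.Gamma (u + n) = (ascPochhammer ℝ n).eval u * Real.Gamma u := by
  induction n with
  | zero => simp
  | succ n ih =>
    rw [ascPochhammer_succ_eval, Nat.cast_succ, ← add_assoc, Real.Gamma_add_one (by positivity), ih]
    ring

theorem choose_coeff (a : ℝ) (n : ℕ) :
    Ring.choose (a + n - 1) n = (n.factorial : ℝ)⁻¹ * (ascPochhammer ℝ n).eval a := by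
  have h := Ring.factorial_nsmul_multichoose_eq_ascPochhammer a n
  rw [Ring.multichoose_eq, Polynomial.ascPochhammer_smeval_eq_eval, nsmul_eq_mul] at h
  rw [← h]
  field_simp

/-- On the disc of convergence, `gaussHyp` is the sum of the hypergeometric series. -/
theorem gaussHyp_eq_ordinaryHypergeometric {a b c x : ℝ} (hb : 0 < b) (hc : b < c)
    (hx : |x| < 1) : gaussHyp a b c x = ordinaryHypergeometric a b c x := by
  have hv : 0 < c - b := sub_pos.2 hc
  have hc0 : 0 < c := hb.trans hc
  have hps := Real.one_div_one_sub_rpow_hasFPowerSeriesOnBall_zero a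
  have hball : ∀ y : ℝ, |y| < 1 → y ∈ Metric.eball (0 : ℝ) 1 := by
    intro y hy
    rw [← ENNReal.ofReal_one, Metric.eball_ofReal]
    simpa using hy
  have hsum := FormalMultilinearSeries.summable_norm_apply _
    (Metric.eball_subset_eball hps.r_le (hball |x| (by simpa using hx)))
  have hsum' : Summable fun n : ℕ => |Ring.choose (a + n - 1) n| * |x| ^ n := by
    refine hsum.congr fun n => ?_
    rw [FormalMultilinearSeries.ofScalars_apply_eq]
    simp
  set F : ℕ → ℝ → ℝ := fun n t =>
    (Ring.choose (a + n - 1) n * x ^ n) * (t ^ ((b + n) - 1) * (1 - t) ^ (c - b - 1)) with hF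
  have hbn : ∀ n : ℕ, 0 < b + n := fun n => by positivity
  have hint : ∀ n, Integrable (F n) (volume.restrict (Set.Ioc 0 1)) := fun n =>
    (integrable_betaKernel (hbn n) hv).const_mul _
  have hpt : ∀ t ∈ Set.Ioc (0 : ℝ) 1, HasSum (fun n => F n t)
      (t ^ (b - 1) * (1 - t) ^ (c - b - 1) * (1 - x * t) ^ (-a)) := by
    intro t ht
    have hxt : |x * t| < 1 := by
      rw [abs_mul, abs_of_pos ht.1]
      exact (mul_le_of_le_one_right (abs_nonneg x) ht.2).trans_lt hx
    have h := hps.hasSum (hball _ hxt)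
    simp only [FormalMultilinearSeries.ofScalars_apply_eq, zero_add] at h
    have h1 : (0 : ℝ) ≤ 1 - x * t := by linarith [(abs_lt.1 hxt).2]
    have := h.mul_left (t ^ (b - 1) * (1 - t) ^ (c - b - 1))
    rw [one_div, ← Real.rpow_neg h1] at this
    refine this.congr_fun ?_
    intro n
    simp only [hF, smul_eq_mul]
    rw [show b + n - 1 = (b - 1) + (n : ℝ) by ring, Real.rpow_add ht.1, Real.rpow_natCast]
    ring
  have hval : ∀ n, ∫ t in Set.Ioc (0 : ℝ) 1, F n t
      = Ring.choose (a + n - 1) n * x ^ n * beta (b + n) (c - b) := fun n => by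
    simp only [hF]
    rw [integral_const_mul, integral_betaKernel (hbn n) hv]
  have hnorm : Summable fun n => ∫ t in Set.Ioc (0 : ℝ) 1, ‖F n t‖ := by
    refine Summable.of_nonneg_of_le (fun n => by positivity) (fun n => ?_)
      (hsum'.mul_right (beta b (c - b)))
    rw [← integral_betaKernel hb hv, ← integral_const_mul]
    refine setIntegral_mono_on (hint n).norm ((integrable_betaKernel hb hv).const_mul _)
      measurableSet_Ioc fun t ht => ?_
    have h1 : (0 : ℝ) ≤ 1 - t := by linarith [ht.2]
    simp only [hF]
    rw [norm_mul, Real.norm_eq_abs, Real.norm_eq_abs, abs_mul, abs_pow,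
      abs_of_nonneg (mul_nonneg (Real.rpow_nonneg ht.1.le _) (Real.rpow_nonneg h1 _))]
    refine mul_le_mul_of_nonneg_left (mul_le_mul_of_nonneg_right ?_ (Real.rpow_nonneg h1 _))
      (by positivity)
    refine Real.rpow_le_rpow_of_exponent_ge ht.1 ht.2 ?_
    linarith [(Nat.cast_nonneg n : (0 : ℝ) ≤ n)]
  have key := hasSum_integral_of_summable_integral_norm hint hnorm
  rw [setIntegral_congr_fun measurableSet_Ioc (fun t ht => (hpt t ht).tsum_eq)] at key
  rw [gaussHyp, intervalIntegral.integral_of_le zero_le_one, ← key.tsum_eq, ← tsum_mul_left,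
    ordinaryHypergeometric_eq_tsum]
  refine tsum_congr fun n => ?_
  have e : b + n + (c - b) = c + n := by ring
  have e' : b + (c - b) = c := by ring
  rw [hval, choose_coeff, smul_eq_mul, beta, beta, e, e', gamma_add_nat hb, gamma_add_nat hc0]
  have g1 := (Real.Gamma_pos_of_pos hb).ne'
  have g2 := (Real.Gamma_pos_of_pos hv).ne'
  have g3 := (Real.Gamma_pos_of_pos hc0).ne'
  have g4 := (ascPochhammer_pos n c hc0).ne'
  field_simp

/-- `gaussHyp` is real analytic on `(-∞, 1)`; hence it is the analytic continuation of the series. -/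
theorem analyticOnNhd_gaussHyp {a b c : ℝ} (hb : 0 < b) (hc : b < c) :
    AnalyticOnNhd ℝ (gaussHyp a b c) (Set.Iio 1) := by
  intro y hy
  have hy0 : 0 < 1 - y := sub_pos.2 hy
  have hv : 0 < c - b := sub_pos.2 hc
  have hden : ∀ t ∈ Set.Icc (0 : ℝ) 1, 0 < 1 - y * t := by
    intro t ht
    have h3 := mul_nonneg ht.1 hy0.le
    rcases eq_or_lt_of_le ht.2 with h | h
    · subst h; linarith
    · nlinarith
  have hwle : ∀ t ∈ Set.Icc (0 : ℝ) 1, t / (1 - y * t) ≤ 1 / (1 - y) := by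
    intro t ht
    rw [div_le_div_iff₀ (hden t ht) hy0]
    linarith [ht.2]
  have hps := Real.one_div_one_sub_rpow_hasFPowerSeriesOnBall_zero a
  have hball : ∀ y : ℝ, |y| < 1 → y ∈ Metric.eball (0 : ℝ) 1 := by
    intro y hy
    rw [← ENNReal.ofReal_one, Metric.eball_ofReal]
    simpa using hy
  set K : ℝ → ℝ := fun t => t ^ (b - 1) * (1 - t) ^ (c - b - 1) * (1 - y * t) ^ (-a) with hK
  have hKint : IntegrableOn K (Set.Icc 0 1) := by
    refine IntegrableOn.mul_continuousOn
      ((integrableOn_Icc_iff_integrableOn_Ioc).2 (integrable_betaKernel hb hv)) ?_ isCompact_Icc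
    exact ContinuousOn.rpow_const (by fun_prop) fun t ht => Or.inl (hden t ht).ne'
  set F : ℕ → ℝ → ℝ := fun n t =>
    Ring.choose (a + n - 1) n * (K t * (t / (1 - y * t)) ^ n) with hF
  have hint : ∀ n, Integrable (F n) (volume.restrict (Set.Icc 0 1)) := fun n => by
    refine Integrable.const_mul (IntegrableOn.mul_continuousOn hKint ?_ isCompact_Icc) _
    exact (continuousOn_id.div (by fun_prop) fun t ht => (hden t ht).ne').pow n
  refine ⟨.ofScalars ℝ fun n => (beta b (c - b))⁻¹ * ∫ t in Set.Icc (0 : ℝ) 1, F n t, ?_⟩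
  rw [hasFPowerSeriesAt_iff]
  filter_upwards [Metric.ball_mem_nhds (0 : ℝ) hy0] with z hz
  rw [mem_ball_zero_iff, Real.norm_eq_abs] at hz
  set ρ := |z| * (1 / (1 - y)) with hρ
  have hρ0 : 0 ≤ ρ := by positivity
  have hρ1 : ρ < 1 := by rw [hρ, mul_one_div, div_lt_one hy0]; exact hz
  have hsum := FormalMultilinearSeries.summable_norm_apply _
    (Metric.eball_subset_eball hps.r_le (hball ρ (by rwa [abs_of_nonneg hρ0])))
  have hsum' : Summable fun n : ℕ => |Ring.choose (a + n - 1) n| * ρ ^ n := by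
    refine hsum.congr fun n => ?_
    rw [FormalMultilinearSeries.ofScalars_apply_eq]
    simp [abs_of_nonneg hρ0]
  have hpt : ∀ t ∈ Set.Icc (0 : ℝ) 1, HasSum (fun n => z ^ n * F n t)
      (t ^ (b - 1) * (1 - t) ^ (c - b - 1) * (1 - (y + z) * t) ^ (-a)) := by
    intro t ht
    have hd := hden t ht
    have hw0 : 0 ≤ t / (1 - y * t) := div_nonneg ht.1 hd.le
    have hzw : |z * (t / (1 - y * t))| < 1 := by
      rw [abs_mul, abs_of_nonneg hw0]
      exact (mul_le_mul_of_nonneg_left (hwle t ht) (abs_nonneg z)).trans_lt hρ1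
    have h := hps.hasSum (hball _ hzw)
    simp only [FormalMultilinearSeries.ofScalars_apply_eq, zero_add] at h
    have h1 : (0 : ℝ) ≤ 1 - z * (t / (1 - y * t)) := by linarith [(abs_lt.1 hzw).2]
    have := h.mul_left (K t)
    rw [one_div, ← Real.rpow_neg h1, hK] at this
    simp only [] at this
    rw [mul_assoc (t ^ (b - 1) * (1 - t) ^ (c - b - 1)), ← Real.mul_rpow hd.le h1,
      show (1 - y * t) * (1 - z * (t / (1 - y * t))) = 1 - (y + z) * t by
        field_simp; ring] at this
    refine this.congr_fun ?_
    intro n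
    simp only [hF, hK, smul_eq_mul]
    rw [mul_pow]
    ring
  have hint' : ∀ n, Integrable (fun t => z ^ n * F n t) (volume.restrict (Set.Icc 0 1)) :=
    fun n => (hint n).const_mul _
  have hnorm : Summable fun n => ∫ t in Set.Icc (0 : ℝ) 1, ‖z ^ n * F n t‖ := by
    refine Summable.of_nonneg_of_le (fun n => by positivity) (fun n => ?_)
      (hsum'.mul_right (∫ t in Set.Icc (0 : ℝ) 1, |K t|))
    rw [← integral_const_mul]
    refine setIntegral_mono_on (hint' n).norm (hKint.abs.const_mul _)
      measurableSet_Icc fun t ht => ?_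
    have hw0 : 0 ≤ t / (1 - y * t) := div_nonneg ht.1 (hden t ht).le
    have hle : (|z| * (t / (1 - y * t))) ^ n ≤ ρ ^ n :=
      pow_le_pow_left₀ (by positivity) (mul_le_mul_of_nonneg_left (hwle t ht) (abs_nonneg z)) n
    simp only [hF, Real.norm_eq_abs]
    rw [abs_mul, abs_mul, abs_mul, abs_pow, abs_pow, abs_of_nonneg hw0]
    calc |z| ^ n * (|Ring.choose (a + n - 1) n| * (|K t| * (t / (1 - y * t)) ^ n))
        = |Ring.choose (a + n - 1) n| * (|z| * (t / (1 - y * t))) ^ n * |K t| := by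
          rw [mul_pow]; ring
      _ ≤ _ := by gcongr
  have key := hasSum_integral_of_summable_integral_norm hint' hnorm
  rw [setIntegral_congr_fun measurableSet_Icc (fun t ht => (hpt t ht).tsum_eq)] at key
  have key2 := key.mul_left (beta b (c - b))⁻¹
  rw [gaussHyp, intervalIntegral.integral_of_le zero_le_one, ← integral_Icc_eq_integral_Ioc]
  refine key2.congr_fun ?_
  intro n
  rw [integral_const_mul, FormalMultilinearSeries.coeff_ofScalars, smul_eq_mul]
  ring

/-- `κ₁(γ) = δ γ^δ B(1 - δ, δ)` with `δ = 2 / α`. -/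
def kappa1 (α γ : ℝ) : ℝ :=
  (2 / α) * γ ^ (2 / α) * beta (1 - 2 / α) (2 / α)

/-- `κ₂(γ) = (δ γ / (1 - δ)) ₂F₁(1, 1 - δ; 2 - δ; -γ)` with `δ = 2 / α`. -/
def kappa2 (α γ : ℝ) : ℝ :=
  (2 / α) * γ / (1 - 2 / α) * gaussHyp 1 (1 - 2 / α) (2 - 2 / α) (-γ)

/-- `τ₁(γ) = 1 + κ₂(γ) - κ₁(γ)`. -/
def tau1 (α γ : ℝ) : ℝ := 1 + kappa2 α γ - kappa1 α γ

/-- `τ₂(γ) = κ₁(γ) exp(π λₑ D²)`. -/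
def tau2 (lamE D α γ : ℝ) : ℝ := kappa1 α γ * Real.exp (Real.pi * lamE * D ^ 2)

/-! ### Densities -/

/-- The probability `exp(-λₑ π D²)` that no eavesdropper lies in a guard zone. -/
def activeProb (lamE D : ℝ) : ℝ := Real.exp (-lamE * Real.pi * D ^ 2)

/-- Density `λᵢᶜ = (1 - pᵢ) λ` of the base stations without the file. -/
def lamC (lam p : ℝ) : ℝ := (1 - p) * lam

/-- Density `λₐᵢ = pᵢ λ exp(-λₑ π D²)` of the actual transmitters of the file. -/
def lamA (lam lamE p D : ℝ) : ℝ := p * lam * activeProb lamE D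

/-- Density `pᵢ λ (1 - exp(-λₑ π D²))` of the silenced holders of the file. -/
def lamB (lam lamE p D : ℝ) : ℝ := p * lam * (1 - activeProb lamE D)

/-- The density on `r > D` of the distance to the nearest actual transmitter outside the disk of
radius `D`. -/
def distPDF (lam lamE p D r : ℝ) : ℝ :=
  2 * Real.pi * lamA lam lamE p D * r *
    Real.exp (-Real.pi * lamA lam lamE p D * (r ^ 2 - D ^ 2))

/-- `Θ(r) = -π λₐᵢ D² ₂F₁(1, δ; δ + 1; -D^α / (γ r^α))` with `δ = 2 / α`. -/
def Theta (lam lamE p D α γ r : ℝ) : ℝ :=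
  -Real.pi * lamA lam lamE p D * D ^ 2 *
    gaussHyp 1 (2 / α) (2 / α + 1) (-(D ^ α / (γ * r ^ α)))

/-- The integrand of the secrecy probability at distance `r`, with the hypergeometric term `Θ`
replaced by the number `θ`. -/
def integrand (lam lamE p D α γ θ r : ℝ) : ℝ :=
  Real.exp (-Real.pi * ((lamC lam p + lamB lam lamE p D) * kappa1 α γ
      + lamA lam lamE p D * kappa2 α γ) * r ^ 2 + θ) *
    distPDF lam lamE p D r

/-- `1 - exp(-π D² κ₁(γ) λ) / (τ₁(γ) + τ₂(γ) / pᵢ)`. -/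
def lowerBound (lam lamE p D α γ : ℝ) : ℝ :=
  1 - Real.exp (-Real.pi * D ^ 2 * kappa1 α γ * lam) / (tau1 α γ + tau2 lamE D α γ / p)

/-! ### The network -/

/-- The Euclidean plane. -/
abbrev Plane : Type := EuclideanSpace ℝ (Fin 2)

variable {Ω : Type*} [MeasurableSpace Ω]

/-- The number of points of the random sequence `X` that lie in `B`. -/
def pointCount (X : ℕ → Ω → Plane) (B : Set Plane) (ω : Ω) : ℕ∞ :=
  {n | X n ω ∈ B}.encard

/-- The random points `X 0, X 1, …` enumerate a homogeneous Poisson point process of density `lam`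
in the plane: counts are Poisson distributed, and independent over disjoint sets. -/
structure IsPoissonProcess (μ : Measure Ω) (lam : ℝ) (X : ℕ → Ω → Plane) : Prop where
  measurable_point : ∀ n, Measurable (X n)
  law_count : ∀ B : Set Plane, MeasurableSet B → volume B ≠ ⊤ →
    HasLaw (pointCount X B)
      ((poissonMeasure (Real.toNNReal (lam * volume.real B))).map (Nat.cast : ℕ → ℕ∞)) μ
  indep_count : ∀ (k : ℕ) (B : Fin k → Set Plane), (∀ j, MeasurableSet (B j)) →
    Pairwise (Function.onFun Disjoint B) → iIndepFun (fun j => pointCount X (B j)) μ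

/-- A coin that shows `true` with probability `q`. -/
def coin (q : ℝ) : Measure Bool :=
  ENNReal.ofReal q • Measure.dirac true + ENNReal.ofReal (1 - q) • Measure.dirac false

/-- The base stations as seen from the typical eavesdropper at the origin, for one file: a
homogeneous Poisson process of density `lam`, whose points carry independent marks (independent of
the process). The three components of a mark are independent: the station holds the file with
probability `p`; its guard zone is free of eavesdroppers with probability `exp(-λₑ π D²)`; the
fading gain of its channel to the origin is `Exp(1)`. -/
structure Network (μ : Measure Ω) (lam lamE p D : ℝ) where
  /-- locations of the base stations -/
  loc : ℕ → Ω → Plane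
  /-- whether the station holds the file -/
  cached : ℕ → Ω → Bool
  /-- whether the guard zone is clear, so that the file is transmitted if it is held -/
  clear : ℕ → Ω → Bool
  /-- fading gain -/
  fading : ℕ → Ω → ℝ
  isPoisson : IsPoissonProcess μ lam loc
  law_mark : ∀ n, HasLaw (fun ω => (cached n ω, clear n ω, fading n ω))
    ((coin p).prod ((coin (activeProb lamE D)).prod (expMeasure 1))) μ
  indep_mark : iIndepFun (fun n ω => (cached n ω, clear n ω, fading n ω)) μ
  indep_loc_mark : IndepFun (fun ω n => loc n ω)
    (fun ω n => (cached n ω, clear n ω, fading n ω)) μ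

namespace Network

variable {μ : Measure Ω} {lam lamE p D : ℝ} (N : Network μ lam lamE p D)

/-- Base stations without the file. -/
def others (ω : Ω) : Set ℕ := {n | N.cached n ω = false}

/-- Holders of the file that send artificial noise since their guard zone is not clear. -/
def silenced (ω : Ω) : Set ℕ := {n | N.cached n ω = true ∧ N.clear n ω = false}

/-- Actual transmitters of the file. -/
def transmitters (ω : Ω) : Set ℕ := {n | N.cached n ω = true ∧ N.clear n ω = true}

/-- Base stations in the disk of radius `D` around the eavesdropper. -/
def inDisk (ω : Ω) : Set ℕ := {n | N.loc n ω ∈ Metric.closedBall (0 : Plane) D}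

/-- `n` is the station that the eavesdropper listens to: it maximizes `P ‖X‖^(-α)` over the actual
transmitters outside the disk. -/
def IsTarget (P α : ℝ) (ω : Ω) (n : ℕ) : Prop :=
  n ∈ N.transmitters ω \ N.inDisk ω ∧
    ∀ m ∈ N.transmitters ω \ N.inDisk ω,
      P * ‖N.loc m ω‖ ^ (-α) ≤ P * ‖N.loc n ω‖ ^ (-α)

/-- Power received at the origin from station `n`. -/
def power (P α : ℝ) (ω : Ω) (n : ℕ) : ENNReal :=
  ENNReal.ofReal (P * N.fading n ω * ‖N.loc n ω‖ ^ (-α))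

/-- Total interference when the eavesdropper listens to station `e`. -/
def interference (P α : ℝ) (ω : Ω) (e : ℕ) : ENNReal :=
  (∑' n : ↥(N.others ω ∪ N.silenced ω), N.power P α ω n)
    + (∑' n : ↥((N.transmitters ω \ N.inDisk ω) \ {e}), N.power P α ω n)
    + ∑' n : ↥(N.transmitters ω ∩ N.inDisk ω), N.power P α ω n

/-- The secrecy probability: the signal-to-interference ratio of the station that the eavesdropper
listens to is below the threshold `γ`. -/
def secrecyProb (P α γ : ℝ) : ℝ :=
  μ.real {ω | ∀ e, N.IsTarget P α ω e →
    N.power P α ω e / N.interference P α ω e < ENNReal.ofReal γ}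

end Network

end CacheSecrecy

end

namespace CacheSecrecy

open Set Filter Topology
open scoped ENNReal NNReal

/-! The eavesdropper succeeds when the nearest active station `e` outside the disk has fading at
least `γ ‖X_e‖^α ∑_{n ≠ e} h_n ‖X_n‖^(-α)`. Exponential fading satisfies `P(h ≥ s) = exp (-s)`, so
success becomes the expectation of a product over the other stations. The condition of being nearest
enters the same product: a closer active station outside the disk is charged the cost `∞`, and `exp
(-∞) = 0`. The independent marks are then integrated out station by station
(`measure_marked_tsum_le`), which leaves the functional `palm` of the locations alone.

The Poisson process is given only through its counts, so the needed Campbell-Mecke formula is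
derived by hand. The costs increase with the radius of the distinguished station. Hence the
contribution of a thin annulus lies between two expressions that agree to first order, both computed
by the Laplace functional `lintegral_mul_expNeg_tsum`; this yields a right derivative in the radius
(`palm_eq_integral`). The exponent is a radial integral whose pieces over `(0, ∞)`, `(r, ∞)` and
`(0, D]` are `κ₁`, `κ₂` and the hypergeometric factor of `Θ` (`exponent_eq`).

For `γ = 0` the same computation counts the nearest active stations. Their expected number within
distance `t` equals the probability that some active station lies there, found independently as a
void probability. Hence the nearest station is almost surely unique (`ae_tsum_capture_zero`), and
the capture probabilities add up to the probability of a union.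

For the bound, `₂F₁(1, b; b + 1; ·)` is strictly increasing on `(-∞, 0]`, so `Θ(r) < Θ(D)` for `r >
D`. With the constant `Θ(D)` the integrand is a multiple of `r exp (-b r²)`, and `kappa1_eq`
collapses the constants to the closed form. -/

/-! ### The exponential `exp (-x)` on `[0, ∞]`. -/

/-- The function `x ↦ exp (-x)` on `[0, ∞]`, with `exp (-∞) = 0`. -/
noncomputable def expNeg (x : ℝ≥0∞) : ℝ≥0∞ := EReal.exp (-(x : EReal))

@[simp] theorem expNeg_zero : expNeg 0 = 1 := by simp [expNeg]

@[simp] theorem expNeg_top : expNeg ⊤ = 0 := by simp [expNeg]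

theorem expNeg_ofReal {a : ℝ} (ha : 0 ≤ a) :
    expNeg (ENNReal.ofReal a) = ENNReal.ofReal (Real.exp (-a)) := by
  rw [expNeg, EReal.coe_ennreal_ofReal, max_eq_left ha, ← EReal.coe_neg, EReal.exp_coe]

theorem expNeg_add (x y : ℝ≥0∞) : expNeg (x + y) = expNeg x * expNeg y := by
  rw [expNeg, expNeg, expNeg, ← EReal.exp_add, EReal.coe_ennreal_add, EReal.neg_add, sub_eq_add_neg]
  · left; simp
  · right; simp

theorem antitone_expNeg : Antitone expNeg := fun x y h => by
  rw [expNeg, expNeg, EReal.exp_le_exp_iff, EReal.neg_le_neg_iff]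
  exact_mod_cast h

theorem expNeg_le_one (x : ℝ≥0∞) : expNeg x ≤ 1 := by
  rw [← expNeg_zero]; exact antitone_expNeg (zero_le)

theorem expNeg_ne_top (x : ℝ≥0∞) : expNeg x ≠ ⊤ :=
  ((expNeg_le_one x).trans_lt ENNReal.one_lt_top).ne

theorem continuous_expNeg : Continuous expNeg :=
  ENNReal.continuous_exp.comp (continuous_neg.comp continuous_coe_ennreal_ereal)

@[fun_prop]
theorem measurable_expNeg : Measurable expNeg := continuous_expNeg.measurable

theorem expNeg_sum {ι : Type*} (s : Finset ι) (f : ι → ℝ≥0∞) :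
    expNeg (∑ i ∈ s, f i) = ∏ i ∈ s, expNeg (f i) := by
  classical
  induction s using Finset.induction_on with
  | empty => simp
  | insert a s ha ih => rw [Finset.sum_insert ha, Finset.prod_insert ha, expNeg_add, ih]

theorem expNeg_nat_mul (n : ℕ) (c : ℝ≥0∞) : expNeg (n * c) = expNeg c ^ n := by
  have := expNeg_sum (Finset.range n) (fun _ => c)
  simpa using this

theorem tendsto_expNeg_tsum (f : ℕ → ℝ≥0∞) :
    Tendsto (fun N => ∏ n ∈ Finset.range N, expNeg (f n)) atTop (𝓝 (expNeg (∑' n, f n))) := by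
  simp_rw [← expNeg_sum]
  exact (continuous_expNeg.tendsto _).comp ENNReal.summable.hasSum.tendsto_sum_nat

/-! ### Counts and the Laplace functional of a Poisson process. -/

variable {Ω : Type*}

theorem pointCount_eq_tsum (X : ℕ → Ω → Plane) (B : Set Plane) (ω : Ω) :
    ((pointCount X B ω : ℕ∞) : ℝ≥0∞) = ∑' n, B.indicator 1 (X n ω) := by
  rw [pointCount, ← ENNReal.tsum_set_one, tsum_subtype {n | X n ω ∈ B} (fun _ => (1 : ℝ≥0∞))]
  rfl

theorem measurable_toENNReal : Measurable (fun n : ℕ∞ => (n : ℝ≥0∞)) := measurable_from_top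

namespace IsPoissonProcess

variable [MeasurableSpace Ω] {μ : Measure Ω} {lam : ℝ} {X : ℕ → Ω → Plane}

theorem lintegral_apply_count (hX : IsPoissonProcess μ lam X) (hlam : 0 ≤ lam) {B : Set Plane}
    (hB : MeasurableSet B) (hBv : volume B ≠ ⊤) (φ : ℕ∞ → ℝ≥0∞) :
    ∫⁻ ω, φ (pointCount X B ω) ∂μ = ∑' k : ℕ, φ k *
      ENNReal.ofReal (Real.exp (-(lam * volume.real B)) * (lam * volume.real B) ^ k / k.factorial) := by
  have h0 : 0 ≤ lam * volume.real B := mul_nonneg hlam measureReal_nonneg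
  rw [(hX.law_count B hB hBv).lintegral_comp (f := φ) measurable_from_top.aemeasurable,
    lintegral_map measurable_from_top measurable_from_top, lintegral_countable']
  refine tsum_congr fun k => ?_
  rw [poissonMeasure_singleton, Real.coe_toNNReal _ h0]

/-- This is the Poisson generating function `E s^N = exp (-r (1 - s))` at `s = exp (-c)`. The value
`c = ∞` is allowed and gives the void probability. -/
theorem lintegral_expNeg_count (hX : IsPoissonProcess μ lam X) (hlam : 0 ≤ lam) {B : Set Plane}
    (hB : MeasurableSet B) (hBv : volume B ≠ ⊤) (c : ℝ≥0∞) :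
    ∫⁻ ω, expNeg (c * (pointCount X B ω : ℕ∞)) ∂μ =
      expNeg (ENNReal.ofReal lam * volume B * (1 - expNeg c)) := by
  rw [hX.lintegral_apply_count hlam hB hBv (fun n => expNeg (c * n))]
  set r := lam * volume.real B with hr
  have h0 : 0 ≤ r := mul_nonneg hlam measureReal_nonneg
  set s := (expNeg c).toReal with hs
  have hs0 : 0 ≤ s := ENNReal.toReal_nonneg
  have hs1 : s ≤ 1 := ENNReal.toReal_le_of_le_ofReal zero_le_one (by simpa using expNeg_le_one c)
  have hsc : expNeg c = ENNReal.ofReal s := (ENNReal.ofReal_toReal (expNeg_ne_top c)).symm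
  have hsum : HasSum (fun k : ℕ => Real.exp (-r) * ((r * s) ^ k / k.factorial))
      (Real.exp (-r) * Real.exp (r * s)) := by
    rw [Real.exp_eq_exp_ℝ]
    exact (NormedSpace.expSeries_div_hasSum_exp (r * s)).mul_left _
  have h1 : ∀ k : ℕ, expNeg (c * ((k : ℕ∞) : ℝ≥0∞)) *
      ENNReal.ofReal (Real.exp (-r) * r ^ k / k.factorial) =
      ENNReal.ofReal (Real.exp (-r) * ((r * s) ^ k / k.factorial)) := by
    intro k
    rw [ENat.toENNReal_coe, mul_comm c, expNeg_nat_mul, hsc, ← ENNReal.ofReal_pow hs0,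
      ← ENNReal.ofReal_mul (by positivity)]
    congr 1
    rw [mul_pow]; ring
  rw [tsum_congr h1, ← ENNReal.ofReal_tsum_of_nonneg (fun k => by positivity) hsum.summable,
    hsum.tsum_eq]
  have h2 : ENNReal.ofReal lam * volume B * (1 - expNeg c) = ENNReal.ofReal (r * (1 - s)) := by
    rw [ENNReal.ofReal_mul h0, hr, ENNReal.ofReal_mul hlam, ENNReal.ofReal_sub _ hs0, ← hsc,
      ENNReal.ofReal_one, measureReal_def, ENNReal.ofReal_toReal hBv]
  rw [h2, expNeg_ofReal (mul_nonneg h0 (by linarith)), ← Real.exp_add]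
  congr 2; ring

theorem lintegral_pointCount (hX : IsPoissonProcess μ lam X) (hlam : 0 ≤ lam) {B : Set Plane}
    (hB : MeasurableSet B) (hBv : volume B ≠ ⊤) :
    ∫⁻ ω, (pointCount X B ω : ℕ∞) ∂μ = ENNReal.ofReal lam * volume B := by
  rw [hX.lintegral_apply_count hlam hB hBv (fun n => (n : ℝ≥0∞))]
  set r := lam * volume.real B with hr
  have h0 : 0 ≤ r := mul_nonneg hlam measureReal_nonneg
  have h1 : ∀ k : ℕ, (((k + 1 : ℕ) : ℕ∞) : ℝ≥0∞) *
      ENNReal.ofReal (Real.exp (-r) * r ^ (k + 1) / (k + 1).factorial) =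
      ENNReal.ofReal r * ENNReal.ofReal (Real.exp (-r) * (r ^ k / k.factorial)) := by
    intro k
    rw [ENat.toENNReal_coe, ← ENNReal.ofReal_natCast, ← ENNReal.ofReal_mul (by positivity),
      ← ENNReal.ofReal_mul h0]
    congr 1
    rw [Nat.factorial_succ]
    push_cast
    field_simp
    ring
  have hsum : HasSum (fun k : ℕ => Real.exp (-r) * (r ^ k / k.factorial))
      (Real.exp (-r) * Real.exp r) := by
    rw [Real.exp_eq_exp_ℝ]
    exact (NormedSpace.expSeries_div_hasSum_exp r).mul_left _
  -- The term `k = 0` vanishes; after the shift, `(k + 1) / (k + 1)! = 1 / k!` restores the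
  -- exponential series.
  rw [tsum_eq_zero_add' ENNReal.summable, tsum_congr h1, ENNReal.tsum_mul_left,
    ← ENNReal.ofReal_tsum_of_nonneg (fun k => by positivity) hsum.summable, hsum.tsum_eq,
    ← Real.exp_add]
  simp [hr, ENNReal.ofReal_mul hlam, measureReal_def, ENNReal.ofReal_toReal hBv]

theorem measurable_pointCount (hX : IsPoissonProcess μ lam X) {B : Set Plane}
    (hB : MeasurableSet B) : Measurable (pointCount X B) := by
  have h : Measurable fun ω => ((pointCount X B ω : ℕ∞) : ℝ≥0∞) := by
    simp_rw [pointCount_eq_tsum]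
    exact Measurable.tsum fun n => (measurable_one.indicator hB).comp (hX.measurable_point n)
  rw [ENat.measurable_iff]
  intro n
  have h2 := h (measurableSet_singleton ((n : ℕ∞) : ℝ≥0∞))
  convert h2 using 1
  ext ω
  simp only [mem_preimage, mem_singleton_iff]
  exact ENat.toENNReal_inj.symm

/-- The weight of a single point in a thin annulus, which drives the lower bound `le_palm`. -/
theorem lintegral_count_eq_one (hX : IsPoissonProcess μ lam X) (hlam : 0 ≤ lam) {B : Set Plane}
    (hB : MeasurableSet B) (hBv : volume B ≠ ⊤) :
    ∫⁻ ω, ({1} : Set ℕ∞).indicator 1 (pointCount X B ω) ∂μ =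
      ENNReal.ofReal (lam * volume.real B * Real.exp (-(lam * volume.real B))) := by
  rw [hX.lintegral_apply_count hlam hB hBv, tsum_eq_single 1]
  · simp [mul_comm]
  · intro k hk
    rw [indicator_of_notMem, zero_mul]
    simpa using hk

/-- The Laplace functional of a Poisson process on finitely many disjoint sets, jointly with the
count on another set. -/
theorem lintegral_mul_prod_expNeg (hX : IsPoissonProcess μ lam X) (hlam : 0 ≤ lam) {ι : Type*}
    [Fintype ι] {A : Set Plane} (hA : MeasurableSet A) (φ : ℕ∞ → ℝ≥0∞) (B : ι → Set Plane)
    (hB : ∀ i, MeasurableSet (B i)) (hBv : ∀ i, volume (B i) ≠ ⊤)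
    (hd : Pairwise (Function.onFun Disjoint B)) (hAB : ∀ i, Disjoint A (B i)) (c : ι → ℝ≥0∞) :
    ∫⁻ ω, φ (pointCount X A ω) * ∏ i, expNeg (c i * (pointCount X (B i) ω : ℕ∞)) ∂μ =
      (∫⁻ ω, φ (pointCount X A ω) ∂μ) *
        ∏ i, expNeg (ENNReal.ofReal lam * volume (B i) * (1 - expNeg (c i))) := by
  -- The index `none` stands for `A`, so one family of disjoint sets yields the joint independence
  -- of all the counts.
  let C : Option ι → Set Plane := fun o => o.elim A B
  have hC : ∀ o, MeasurableSet (C o) := by rintro (_ | i) <;> simp [C, hA, hB]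
  have hCd : Pairwise (Function.onFun Disjoint C) := by
    rintro (_ | i) (_ | j) hij
    · exact absurd rfl hij
    · exact hAB j
    · exact (hAB i).symm
    · exact hd (fun h => hij (by rw [h]))
  let e := Fintype.equivFin (Option ι)
  have hind : iIndepFun (fun o => pointCount X (C o)) μ := by
    have h := (hX.indep_count _ (fun j => C (e.symm j)) (fun j => hC _)
      (fun i j hij => hCd (fun h => hij (e.symm.injective h)))).precomp e.injective
    simpa using h
  let ψ : Option ι → ℕ∞ → ℝ≥0∞ := fun o => o.elim φ (fun i n => expNeg (c i * n))
  have hind2 : iIndepFun (fun o ω => ψ o (pointCount X (C o) ω)) μ :=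
    hind.comp ψ (fun o => measurable_from_top)
  have hmeas : ∀ o, Measurable fun ω => ψ o (pointCount X (C o) ω) := fun o =>
    measurable_from_top.comp (hX.measurable_pointCount (hC o))
  have key := lintegral_prod_eq_prod_lintegral_of_indepFun Finset.univ _ hind2 hmeas
  simp only [Fintype.prod_option] at key
  refine key.trans ?_
  congr 1
  refine Finset.prod_congr rfl fun i _ => ?_
  exact hX.lintegral_expNeg_count hlam (hB i) (hBv i) (c i)

/-- The level sets of a simple function are disjoint, so the functional factors into the generating
functions of independent counts. -/
theorem lintegral_simpleFunc (hX : IsPoissonProcess μ lam X) (hlam : 0 ≤ lam) {A : Set Plane}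
    (hA : MeasurableSet A) (φ : ℕ∞ → ℝ≥0∞) (g : SimpleFunc Plane ℝ≥0∞)
    (hg : volume (Function.support g) ≠ ⊤) (hgA : ∀ x ∈ A, g x = 0) :
    ∫⁻ ω, φ (pointCount X A ω) * expNeg (∑' n, g (X n ω)) ∂μ =
      (∫⁻ ω, φ (pointCount X A ω) ∂μ) *
        expNeg (ENNReal.ofReal lam * ∫⁻ x, (1 - expNeg (g x))) := by
  -- The value `0` is left out: its level set has infinite volume and meets `A`, and it contributes
  -- nothing.
  let ι := {c // c ∈ g.range.erase 0}
  let B : ι → Set Plane := fun c => g ⁻¹' {c.1}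
  have hc0 : ∀ c : ι, c.1 ≠ 0 := fun c => (Finset.mem_erase.1 c.2).1
  have hB : ∀ i, MeasurableSet (B i) := fun i => g.measurableSet_fiber _
  have hBv : ∀ i, volume (B i) ≠ ⊤ := fun i => by
    refine ne_top_of_le_ne_top hg (measure_mono fun x hx => ?_)
    have hx' : g x = i.1 := hx
    rw [Function.mem_support, hx']
    exact hc0 i
  have hd : Pairwise (Function.onFun Disjoint B) := by
    intro i j hij
    rw [Function.onFun, Set.disjoint_left]
    intro x hx hy
    exact hij (Subtype.ext ((show g x = i.1 from hx).symm.trans hy))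
  have hAB : ∀ i, Disjoint A (B i) := fun i => by
    rw [Set.disjoint_left]
    intro x hx hy
    exact hc0 i ((show g x = i.1 from hy).symm.trans (hgA x hx))
  -- Used twice: with the identity for the sum over the points, and with `1 - exp (-c)` for the
  -- exponent.
  have hrep : ∀ (ψ : ℝ≥0∞ → ℝ≥0∞), ψ 0 = 0 → ∀ x,
      ψ (g x) = ∑ i : ι, ψ i.1 * (B i).indicator 1 x := by
    intro ψ hψ x
    by_cases hx : g x = 0
    · rw [hx, hψ, Finset.sum_eq_zero]
      intro i _
      rw [indicator_of_notMem, mul_zero]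
      intro h
      exact hc0 i ((show g x = i.1 from h).symm.trans hx)
    · rw [Finset.sum_eq_single ⟨g x, Finset.mem_erase.2 ⟨hx, g.mem_range_self x⟩⟩]
      · simp [B]
      · intro j _ hj
        rw [indicator_of_notMem, mul_zero]
        intro h
        exact hj (Subtype.ext (show g x = j.1 from h).symm)
      · simp
  have hL : ∀ ω, expNeg (∑' n, g (X n ω)) =
      ∏ i : ι, expNeg (i.1 * (pointCount X (B i) ω : ℕ∞)) := by
    intro ω
    rw [← expNeg_sum]
    congr 1
    simp_rw [pointCount_eq_tsum, ← ENNReal.tsum_mul_left]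
    rw [← Summable.tsum_finsetSum fun i _ => ENNReal.summable]
    exact tsum_congr fun n => hrep id rfl _
  simp_rw [hL]
  rw [hX.lintegral_mul_prod_expNeg hlam hA φ B hB hBv hd hAB, ← expNeg_sum]
  congr 2
  simp_rw [hrep (fun c => 1 - expNeg c) (by simp)]
  rw [lintegral_finsetSum _ (fun i _ => by
    exact (measurable_one.indicator (hB i)).const_mul _), Finset.mul_sum]
  refine Finset.sum_congr rfl fun i _ => ?_
  rw [lintegral_const_mul _ (measurable_one.indicator (hB i)), lintegral_indicator_one (hB i)]
  ring

/-- The Laplace functional of a Poisson process, jointly with the count on a set where the test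
function vanishes. -/
theorem lintegral_mul_expNeg_tsum (hX : IsPoissonProcess μ lam X) (hlam : 0 ≤ lam) {A : Set Plane}
    (hA : MeasurableSet A) (φ : ℕ∞ → ℝ≥0∞) (hφ : ∫⁻ ω, φ (pointCount X A ω) ∂μ ≠ ⊤)
    {f : Plane → ℝ≥0∞} (hf : Measurable f) (hfA : ∀ x ∈ A, f x = 0) :
    ∫⁻ ω, φ (pointCount X A ω) * expNeg (∑' n, f (X n ω)) ∂μ =
      (∫⁻ ω, φ (pointCount X A ω) ∂μ) *
        expNeg (ENNReal.ofReal lam * ∫⁻ x, (1 - expNeg (f x))) := by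
  -- The cut-off to growing balls gives each approximation a support of finite volume and keeps the
  -- sequence monotone.
  let g : ℕ → SimpleFunc Plane ℝ≥0∞ := fun k =>
    (SimpleFunc.eapprox f k).restrict (Metric.ball 0 k)
  have hgv : ∀ k x, g k x = (Metric.ball (0 : Plane) k).indicator (SimpleFunc.eapprox f k) x :=
    fun k x => by
    rw [SimpleFunc.restrict_apply _ measurableSet_ball]
  have hgmono : Monotone fun k x => g k x := by
    intro j k hjk x
    simp only [hgv]
    have hsub : Metric.ball (0 : Plane) j ⊆ Metric.ball 0 k :=
      Metric.ball_subset_ball (by exact_mod_cast hjk)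
    refine (indicator_le_indicator_of_subset hsub (fun _ => zero_le) x).trans ?_
    exact indicator_le_indicator (SimpleFunc.monotone_eapprox f hjk x)
  have hgle : ∀ k x, g k x ≤ f x := by
    intro k x
    rw [hgv]
    exact (indicator_le_self _ _ x).trans
      ((le_iSup (fun n => SimpleFunc.eapprox f n x) k).trans (SimpleFunc.iSup_eapprox_apply hf x).le)
  have hglim : ∀ x, Tendsto (fun k => g k x) atTop (𝓝 (f x)) := by
    intro x
    refine (SimpleFunc.tendsto_eapprox hf x).congr' ?_
    obtain ⟨N, hN⟩ := exists_nat_gt ‖x‖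
    filter_upwards [eventually_ge_atTop N] with k hk
    rw [hgv, indicator_of_mem]
    rw [mem_ball_zero_iff]
    exact hN.trans_le (by exact_mod_cast hk)
  have hbase : ∀ k, ∫⁻ ω, φ (pointCount X A ω) * expNeg (∑' n, g k (X n ω)) ∂μ =
      (∫⁻ ω, φ (pointCount X A ω) ∂μ) *
        expNeg (ENNReal.ofReal lam * ∫⁻ x, (1 - expNeg (g k x))) := by
    intro k
    refine hX.lintegral_simpleFunc hlam hA φ (g k) ?_ ?_
    · refine ne_top_of_le_ne_top (measure_ball_lt_top (x := (0 : Plane)) (r := k)).ne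
        (measure_mono fun x hx => ?_)
      by_contra h
      exact hx (by rw [hgv, indicator_of_notMem h])
    · intro x hx
      exact le_antisymm ((hgle k x).trans (hfA x hx).le) (zero_le)
  have hsumlim : ∀ ω, Tendsto (fun k => ∑' n, g k (X n ω)) atTop (𝓝 (∑' n, f (X n ω))) := by
    intro ω
    simp_rw [← MeasureTheory.lintegral_count]
    refine lintegral_tendsto_of_tendsto_of_monotone (fun k => measurable_from_top.aemeasurable)
      (ae_of_all _ fun n j k hjk => hgmono hjk _) (ae_of_all _ fun n => hglim _)
  have hmeasg : ∀ k, Measurable fun ω => ∑' n, g k (X n ω) := fun k =>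
    Measurable.tsum fun n => (g k).measurable.comp (hX.measurable_point n)
  have hmeasφ : Measurable fun ω => φ (pointCount X A ω) :=
    measurable_from_top.comp (hX.measurable_pointCount hA)
  have hl : Tendsto (fun k => ∫⁻ ω, φ (pointCount X A ω) * expNeg (∑' n, g k (X n ω)) ∂μ) atTop
      (𝓝 (∫⁻ ω, φ (pointCount X A ω) * expNeg (∑' n, f (X n ω)) ∂μ)) := by
    refine tendsto_lintegral_of_dominated_convergence (fun ω => φ (pointCount X A ω))
      (fun k => hmeasφ.mul (measurable_expNeg.comp (hmeasg k)))
      (fun k => ae_of_all _ fun ω => mul_le_of_le_one_right (zero_le) (expNeg_le_one _)) hφ ?_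
    filter_upwards [ae_lt_top hmeasφ hφ] with ω hω
    exact ENNReal.Tendsto.const_mul ((continuous_expNeg.tendsto _).comp (hsumlim ω))
      (Or.inr hω.ne)
  have hr : Tendsto (fun k => (∫⁻ ω, φ (pointCount X A ω) ∂μ) *
        expNeg (ENNReal.ofReal lam * ∫⁻ x, (1 - expNeg (g k x)))) atTop
      (𝓝 ((∫⁻ ω, φ (pointCount X A ω) ∂μ) *
        expNeg (ENNReal.ofReal lam * ∫⁻ x, (1 - expNeg (f x))))) := by
    refine ENNReal.Tendsto.const_mul ((continuous_expNeg.tendsto _).comp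
      (ENNReal.Tendsto.const_mul ?_ (Or.inr ENNReal.ofReal_ne_top))) (Or.inr hφ)
    refine lintegral_tendsto_of_tendsto_of_monotone
      (fun k => (measurable_const.sub (measurable_expNeg.comp (g k).measurable)).aemeasurable)
      (ae_of_all _ fun x j k hjk => tsub_le_tsub_left (antitone_expNeg (hgmono hjk x)) _)
      (ae_of_all _ fun x => ?_)
    exact ENNReal.Tendsto.sub tendsto_const_nhds ((continuous_expNeg.tendsto _).comp (hglim x))
      (Or.inl ENNReal.one_ne_top)
  exact tendsto_nhds_unique hl (hr.congr fun k => (hbase k).symm)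

end IsPoissonProcess

/-! ### Integrating out independent marks. -/

section Marks

variable {Ω M : Type*} [MeasurableSpace Ω] [MeasurableSpace M] {μ : Measure Ω} {ν : Measure M}
  {m : ℕ → Ω → M} {X : ℕ → Ω → Plane}

/-- Independence factors the expectation of each finite product. The partial products are bounded by
`1`, so dominated convergence gives the infinite product. -/
theorem lintegral_expNeg_tsum_marks (hm : ∀ n, Measurable (m n)) (hlaw : ∀ n, μ.map (m n) = ν)
    (hind : iIndepFun m μ) {F : ℕ → M → ℝ≥0∞} (hF : ∀ n, Measurable (F n)) {Fb : ℕ → ℝ≥0∞}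
    (h : ∀ n, ∫⁻ x, expNeg (F n x) ∂ν = expNeg (Fb n)) :
    ∫⁻ ω, expNeg (∑' n, F n (m n ω)) ∂μ = expNeg (∑' n, Fb n) := by
  have := hind.isProbabilityMeasure
  have hmeas : ∀ n, Measurable fun ω => expNeg (F n (m n ω)) := fun n =>
    measurable_expNeg.comp ((hF n).comp (hm n))
  have hfin : ∀ N, ∫⁻ ω, ∏ n ∈ Finset.range N, expNeg (F n (m n ω)) ∂μ =
      ∏ n ∈ Finset.range N, expNeg (Fb n) := by
    intro N
    rw [lintegral_prod_eq_prod_lintegral_of_indepFun (Finset.range N)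
      (fun n ω => expNeg (F n (m n ω)))
      (hind.comp (fun n x => expNeg (F n x)) fun n => measurable_expNeg.comp (hF n)) hmeas]
    refine Finset.prod_congr rfl fun n _ => ?_
    rw [← h n, ← hlaw n]
    exact (lintegral_map (measurable_expNeg.comp (hF n)) (hm n)).symm
  have hl : Tendsto (fun N => ∫⁻ ω, ∏ n ∈ Finset.range N, expNeg (F n (m n ω)) ∂μ) atTop
      (𝓝 (∫⁻ ω, expNeg (∑' n, F n (m n ω)) ∂μ)) := by
    refine tendsto_lintegral_of_dominated_convergence (fun _ => 1)
      (fun N => Finset.measurable_fun_prod _ fun n _ => hmeas n)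
      (fun N => ae_of_all _ fun ω => Finset.prod_le_one' fun n _ => expNeg_le_one _)
      (by simp) (ae_of_all _ fun ω => tendsto_expNeg_tsum _)
  exact tendsto_nhds_unique hl ((tendsto_expNeg_tsum Fb).congr fun N => (hfin N).symm)

/-- With the summand at `e` equal to zero, the sum is measurable for the σ-algebra of the other
marks, and that is independent of the mark at `e`. -/
theorem indepFun_tsum_mark (hm : ∀ n, Measurable (m n)) (hind : iIndepFun m μ)
    {F : ℕ → M → ℝ≥0∞} (hF : ∀ n, Measurable (F n)) {e : ℕ} (he : F e = 0) :
    IndepFun (fun ω => ∑' n, F n (m n ω)) (m e) μ := by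
  have hle : ∀ n, MeasurableSpace.comap (m n) ‹_› ≤ ‹MeasurableSpace Ω› := fun n =>
    (hm n).comap_le
  have hI := indep_iSup_of_disjoint hle hind.iIndep
    (show Disjoint ({e}ᶜ : Set ℕ) {e} from disjoint_compl_left)
  rw [IndepFun_iff_Indep]
  refine indep_of_indep_of_le_left (indep_of_indep_of_le_right hI ?_) ?_
  · exact le_iSup₂_of_le (f := fun n (_ : n ∈ ({e} : Set ℕ)) => MeasurableSpace.comap (m n) _)
      e (mem_singleton e) le_rfl
  · rw [← measurable_iff_comap_le]
    have htsum : ∀ (m' : MeasurableSpace Ω), (∀ n, Measurable[m'] fun ω => F n (m n ω)) →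
        Measurable[m'] fun ω => ∑' n, F n (m n ω) := fun m' h => Measurable.tsum h
    refine htsum _ fun n => ?_
    by_cases hn : n = e
    · subst hn
      simp only [he, Pi.zero_apply]
      exact measurable_const
    · refine (hF n).comp ?_
      rw [measurable_iff_comap_le]
      exact le_iSup₂_of_le
        (f := fun n (_ : n ∈ ({e}ᶜ : Set ℕ)) => MeasurableSpace.comap (m n) _) n hn le_rfl

/-- Given the value `s` of the sum, the event at station `e` has probability `q exp (-s)` by the
exponential tail `hq`. Averaging over `s` leaves a Laplace transform of the sum. -/
theorem measure_mark_tsum_le (hm : ∀ n, Measurable (m n)) (hlaw : ∀ n, μ.map (m n) = ν)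
    (hind : iIndepFun m μ) {F : ℕ → M → ℝ≥0∞} (hF : ∀ n, Measurable (F n)) {Fb : ℕ → ℝ≥0∞}
    (h : ∀ n, ∫⁻ x, expNeg (F n x) ∂ν = expNeg (Fb n)) {e : ℕ} (he : F e = 0) {a : Set M}
    (ha : MeasurableSet a) {H : M → ℝ≥0∞} (hH : Measurable H) {q : ℝ≥0∞}
    (hq : ∀ s, ν {x | x ∈ a ∧ s ≤ H x} = q * expNeg s) :
    μ {ω | m e ω ∈ a ∧ ∑' n, F n (m n ω) ≤ H (m e ω)} = q * expNeg (∑' n, Fb n) := by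
  have := hind.isProbabilityMeasure
  have : IsProbabilityMeasure ν := hlaw 0 ▸ Measure.isProbabilityMeasure_map (hm 0).aemeasurable
  have hS : Measurable fun ω => ∑' n, F n (m n ω) := Measurable.tsum fun n => (hF n).comp (hm n)
  have hp := (indepFun_iff_map_prod_eq_prod_map_map hS.aemeasurable (hm e).aemeasurable).1
    (indepFun_tsum_mark hm hind hF he)
  have hT : MeasurableSet {z : ℝ≥0∞ × M | z.2 ∈ a ∧ z.1 ≤ H z.2} :=
    (measurable_snd ha).inter (measurableSet_le measurable_fst (hH.comp measurable_snd))
  have h1 : μ {ω | m e ω ∈ a ∧ ∑' n, F n (m n ω) ≤ H (m e ω)} =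
      μ.map (fun ω => (∑' n, F n (m n ω), m e ω)) {z : ℝ≥0∞ × M | z.2 ∈ a ∧ z.1 ≤ H z.2} := by
    rw [Measure.map_apply (hS.prodMk (hm e)) hT]; rfl
  rw [h1, hp, hlaw, Measure.prod_apply hT]
  have h2 : ∀ s : ℝ≥0∞, ν (Prod.mk s ⁻¹' {z : ℝ≥0∞ × M | z.2 ∈ a ∧ z.1 ≤ H z.2}) =
      q * expNeg s := fun s => hq s
  simp_rw [h2]
  rw [lintegral_map (measurable_expNeg.const_mul q) hS,
    lintegral_const_mul (f := fun ω => expNeg (∑' n, F n (m n ω))) _ (measurable_expNeg.comp hS),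
    lintegral_expNeg_tsum_marks hm hlaw hind hF h]

theorem lintegral_comp_of_indepFun [IsProbabilityMeasure μ] {α β : Type*} [MeasurableSpace α]
    [MeasurableSpace β] {U : Ω → α} {V : Ω → β} (hU : Measurable U) (hV : Measurable V)
    (hUV : IndepFun U V μ) {G : α × β → ℝ≥0∞} (hG : Measurable G) :
    ∫⁻ ω, G (U ω, V ω) ∂μ = ∫⁻ ω, ∫⁻ ω', G (U ω, V ω') ∂μ ∂μ := by
  have hp := (indepFun_iff_map_prod_eq_prod_map_map hU.aemeasurable hV.aemeasurable).1 hUV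
  rw [← lintegral_map (f := G) hG (hU.prodMk hV), hp, lintegral_prod _ hG.aemeasurable,
    lintegral_map hG.lintegral_prod_right' hU]
  refine lintegral_congr fun ω => ?_
  exact lintegral_map (hG.comp measurable_prodMk_left) hV

/-- Integrating out independent marks in a multiplicative functional of the marked points. -/
theorem lintegral_expNeg_tsum_marked [IsProbabilityMeasure μ] (hX : ∀ n, Measurable (X n))
    (hm : ∀ n, Measurable (m n)) (hlaw : ∀ n, μ.map (m n) = ν) (hind : iIndepFun m μ)
    (hXm : IndepFun (fun ω n => X n ω) (fun ω n => m n ω) μ)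
    {F : Plane → M → ℝ≥0∞} (hF : Measurable (Function.uncurry F)) {Fb : Plane → ℝ≥0∞}
    (h : ∀ x, ∫⁻ y, expNeg (F x y) ∂ν = expNeg (Fb x)) :
    ∫⁻ ω, expNeg (∑' n, F (X n ω) (m n ω)) ∂μ = ∫⁻ ω, expNeg (∑' n, Fb (X n ω)) ∂μ := by
  have hG : Measurable fun z : (ℕ → Plane) × (ℕ → M) => expNeg (∑' n, F (z.1 n) (z.2 n)) := by
    refine measurable_expNeg.comp (Measurable.tsum fun n => ?_)
    exact hF.comp (f := fun z : (ℕ → Plane) × (ℕ → M) => (z.1 n, z.2 n)) (by fun_prop)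
  rw [lintegral_comp_of_indepFun (measurable_pi_lambda _ hX) (measurable_pi_lambda _ hm) hXm hG]
  refine lintegral_congr fun ω => ?_
  exact lintegral_expNeg_tsum_marks hm hlaw hind
    (fun n => hF.comp (measurable_const.prodMk measurable_id)) fun n => h _

/-- The probability that station `e` lies in `A`, has a mark in `a`, and that its `H`-value exceeds
the sum of the `F`-values of the other stations. -/
theorem measure_marked_tsum_le [IsProbabilityMeasure μ] (hX : ∀ n, Measurable (X n))
    (hm : ∀ n, Measurable (m n)) (hlaw : ∀ n, μ.map (m n) = ν) (hind : iIndepFun m μ)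
    (hXm : IndepFun (fun ω n => X n ω) (fun ω n => m n ω) μ)
    {F : Plane → Plane → M → ℝ≥0∞} (hF : Measurable fun z : Plane × Plane × M => F z.1 z.2.1 z.2.2)
    {Fb : Plane → Plane → ℝ≥0∞} (hFb : Measurable (Function.uncurry Fb))
    (h : ∀ y x, ∫⁻ z, expNeg (F y x z) ∂ν = expNeg (Fb y x))
    {A : Set Plane} (hA : MeasurableSet A) {a : Set M} (ha : MeasurableSet a) {H : M → ℝ≥0∞}
    (hH : Measurable H) {q : ℝ≥0∞} (hq : ∀ s, ν {x | x ∈ a ∧ s ≤ H x} = q * expNeg s) (e : ℕ) :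
    μ {ω | X e ω ∈ A ∧ m e ω ∈ a ∧
        ∑' n, (if n = e then 0 else F (X e ω) (X n ω) (m n ω)) ≤ H (m e ω)} =
      q * ∫⁻ ω, A.indicator 1 (X e ω) *
        expNeg (∑' n, if n = e then 0 else Fb (X e ω) (X n ω)) ∂μ := by
  have hS : Measurable fun z : (ℕ → Plane) × (ℕ → M) =>
      ∑' n, (if n = e then 0 else F (z.1 e) (z.1 n) (z.2 n)) := by
    refine Measurable.tsum fun n => ?_
    by_cases hn : n = e
    · simp [hn]
    · simp only [hn, if_false]
      exact hF.comp (f := fun z : (ℕ → Plane) × (ℕ → M) => (z.1 e, z.1 n, z.2 n)) (by fun_prop)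
  have hT : MeasurableSet {z : (ℕ → Plane) × (ℕ → M) | z.1 e ∈ A ∧ z.2 e ∈ a ∧
      ∑' n, (if n = e then 0 else F (z.1 e) (z.1 n) (z.2 n)) ≤ H (z.2 e)} :=
    (((measurable_pi_apply e).comp measurable_fst) hA).inter
      ((((measurable_pi_apply e).comp measurable_snd) ha).inter
        (measurableSet_le hS (hH.comp ((measurable_pi_apply e).comp measurable_snd))))
  have hU : Measurable fun ω n => X n ω := measurable_pi_lambda _ hX
  have hV : Measurable fun ω n => m n ω := measurable_pi_lambda _ hm
  have key := lintegral_comp_of_indepFun hU hV hXm (measurable_one.indicator (f := 1) hT)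
  have hl : ∫⁻ ω, indicator {z : (ℕ → Plane) × (ℕ → M) | z.1 e ∈ A ∧ z.2 e ∈ a ∧
      ∑' n, (if n = e then 0 else F (z.1 e) (z.1 n) (z.2 n)) ≤ H (z.2 e)} (1 : (ℕ → Plane) × (ℕ → M) → ℝ≥0∞)
        ((fun n => X n ω), fun n => m n ω) ∂μ = μ {ω | X e ω ∈ A ∧ m e ω ∈ a ∧
        ∑' n, (if n = e then 0 else F (X e ω) (X n ω) (m n ω)) ≤ H (m e ω)} :=
    lintegral_indicator_one ((hU.prodMk hV) hT)
  have hmeasR : Measurable fun ω => A.indicator (1 : Plane → ℝ≥0∞) (X e ω) *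
      expNeg (∑' n, if n = e then 0 else Fb (X e ω) (X n ω)) := by
    refine ((measurable_one.indicator hA).comp (hX e)).mul
      (measurable_expNeg.comp (Measurable.tsum fun n => ?_))
    by_cases hn : n = e
    · simp [hn]
    · simp only [hn, if_false]
      exact hFb.comp ((hX e).prodMk (hX n))
  rw [← hl, key, ← lintegral_const_mul _ hmeasR]
  refine lintegral_congr fun ω => ?_
  by_cases hω : X e ω ∈ A
  · rw [indicator_of_mem hω, Pi.one_apply, one_mul]
    -- With the locations frozen at `ω`, only the marks remain random, and the result for
    -- deterministic cost functions applies.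
    rw [← measure_mark_tsum_le (e := e) hm hlaw hind
      (F := fun n z => if n = e then 0 else F (X e ω) (X n ω) z) (fun n => ?_)
      (fun n => ?_) (by ext; simp) ha hH hq]
    · have hsec : MeasurableSet {ω' | m e ω' ∈ a ∧
          ∑' n, (if n = e then 0 else F (X e ω) (X n ω) (m n ω')) ≤ H (m e ω')} := by
        have := (measurable_prodMk_left (x := fun n => X n ω)).comp hV hT
        convert this using 1
        ext ω'
        simp [hω]
      rw [← lintegral_indicator_one hsec]
      refine lintegral_congr fun ω' => ?_
      simp only [indicator, Pi.one_apply]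
      congr 1
      simp [hω]
    · by_cases hn : n = e
      · simp [hn]
      · simp only [hn, if_false]
        exact hF.comp (measurable_const.prodMk (measurable_const.prodMk measurable_id))
    · by_cases hn : n = e
      · have : IsProbabilityMeasure ν :=
          hlaw 0 ▸ Measure.isProbabilityMeasure_map (hm 0).aemeasurable
        simp [hn]
      · simp only [hn, if_false]
        exact h _ _
  · rw [indicator_of_notMem hω, zero_mul, mul_zero]
    simp [indicator, hω]

end Marks

/-! ### A Campbell-Mecke formula from thin annuli. -/

/-- A function whose increments are squeezed between first order approximations of those of
`∫ 2 c r K(r) dr` equals that integral. -/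
theorem eq_integral_of_increment_bounds {f K : ℝ → ℝ} {c D : ℝ}
    (hK : ContinuousOn K (Ici D)) (hf0 : f D = 0)
    (hmono : ∀ s t, D ≤ s → s ≤ t → f s ≤ f t)
    (hlip : ∀ s t, D ≤ s → s ≤ t → f t - f s ≤ c * (t ^ 2 - s ^ 2))
    (hup : ∀ s t, D ≤ s → s ≤ t →
      f t - f s ≤ c * (t ^ 2 - s ^ 2) * (K s * Real.exp (c * (t ^ 2 - s ^ 2))))
    (hlo : ∀ s t, D ≤ s → s ≤ t →
      c * (t ^ 2 - s ^ 2) * Real.exp (-(c * (t ^ 2 - s ^ 2))) * K t ≤ f t - f s)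
    {t : ℝ} (ht : D ≤ t) : f t = ∫ r in D..t, 2 * c * r * K r := by
  have hKc : ContinuousOn (fun r => 2 * c * r * K r) (Ici D) := by fun_prop
  rw [intervalIntegral.integral_eq_sub_of_hasDeriv_right_of_le ht (f := f), hf0, sub_zero]
  · intro x hx
    have hbound : ∀ y ∈ Icc D t, |f y - f x| ≤ |c * (y ^ 2 - x ^ 2)| := by
      intro y hy
      rcases le_total x y with h | h
      · rw [abs_of_nonneg (sub_nonneg.2 (hmono x y hx.1 h))]
        exact (hlip x y hx.1 h).trans (le_abs_self _)
      · rw [abs_sub_comm, abs_of_nonneg (sub_nonneg.2 (hmono y x hy.1 h))]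
        refine (hlip y x hy.1 h).trans ((le_abs_self _).trans_eq ?_)
        rw [← abs_neg]; congr 1; ring
    refine tendsto_iff_dist_tendsto_zero.2 ?_
    refine squeeze_zero' (Eventually.of_forall fun _ => dist_nonneg)
      (eventually_nhdsWithin_of_forall fun y hy => by rw [Real.dist_eq]; exact hbound y hy)
      (?_ : Tendsto (fun y => |c * (y ^ 2 - x ^ 2)|) _ _)
    have : Continuous fun y : ℝ => |c * (y ^ 2 - x ^ 2)| := by fun_prop
    simpa using (this.tendsto x).mono_left nhdsWithin_le_nhds
  · intro s hs
    rw [hasDerivWithinAt_iff_tendsto_slope' (by simp)]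
    have hKs : Tendsto K (𝓝[>] s) (𝓝 (K s)) :=
      ((hK s hs.1.le).mono (fun x hx => hs.1.le.trans (le_of_lt hx)))
    -- Dividing `c (y² - s²)` by `y - s` gives `c (y + s)`. The signs `σ = -1` and `σ = 1` serve the
    -- lower and the upper bound of the slope, which share the limit `2 c s K(s)`.
    have hA : ∀ σ : ℝ, Tendsto (fun y => c * (y + s) * Real.exp (σ * (c * (y ^ 2 - s ^ 2))))
        (𝓝[>] s) (𝓝 (2 * c * s)) := by
      intro σ
      have : Continuous fun y : ℝ => c * (y + s) * Real.exp (σ * (c * (y ^ 2 - s ^ 2))) := by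
        fun_prop
      have h := (this.tendsto s).mono_left (nhdsWithin_le_nhds (s := Ioi s))
      convert h using 2
      simp; ring
    refine tendsto_of_tendsto_of_tendsto_of_le_of_le' ((hA (-1)).mul hKs)
      ((hA 1).mul_const (K s)) ?_ ?_
    · filter_upwards [self_mem_nhdsWithin] with y hy
      have hy' : 0 < y - s := sub_pos.2 hy
      rw [slope_def_field, le_div_iff₀ hy']
      have := hlo s y hs.1.le (le_of_lt hy)
      rw [neg_one_mul]
      linarith
    · filter_upwards [self_mem_nhdsWithin] with y hy
      have hy' : 0 < y - s := sub_pos.2 hy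
      rw [slope_def_field, div_le_iff₀ hy']
      have := hup s y hs.1.le (le_of_lt hy)
      rw [one_mul]
      linarith
  · exact (hKc.mono (fun x hx => (uIcc_of_le ht ▸ hx : x ∈ Icc D t).1)).intervalIntegrable

/-- The annulus `s < ‖x‖ ≤ t`. -/
def annulus (s t : ℝ) : Set Plane := {x | s < ‖x‖ ∧ ‖x‖ ≤ t}

theorem measurableSet_annulus (s t : ℝ) : MeasurableSet (annulus s t) :=
  (measurableSet_lt measurable_const measurable_norm).inter
    (measurableSet_le measurable_norm measurable_const)

theorem volume_annulus {s t : ℝ} (hs : 0 ≤ s) (hst : s ≤ t) :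
    volume (annulus s t) = ENNReal.ofReal (Real.pi * (t ^ 2 - s ^ 2)) := by
  have h : annulus s t = Metric.closedBall 0 t \ Metric.closedBall 0 s := by
    ext x; simp [annulus, and_comm]
  rw [h, measure_sdiff (Metric.closedBall_subset_closedBall hst)
    measurableSet_closedBall.nullMeasurableSet measure_closedBall_lt_top.ne,
    EuclideanSpace.volume_closedBall_fin_two, EuclideanSpace.volume_closedBall_fin_two,
    ← ENNReal.ofReal_pow hs, ← ENNReal.ofReal_pow (hs.trans hst),
    ← ENNReal.ofReal_mul (by positivity), ← ENNReal.ofReal_mul (by positivity),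
    ← ENNReal.ofReal_sub _ (by positivity)]
  congr 1; ring

section Palm

variable {Ω : Type*} [MeasurableSpace Ω] {μ : Measure Ω} {lam : ℝ} {X : ℕ → Ω → Plane}

/-- The contribution of the station `e`, if it lies in the annulus `s < ‖x‖ ≤ t`, to the Palm type
functional with the radius dependent test function `f`. -/
noncomputable def palmTerm (X : ℕ → Ω → Plane) (f : ℝ → Plane → ℝ≥0∞) (s t : ℝ) (e : ℕ) (ω : Ω) :
    ℝ≥0∞ :=
  (annulus s t).indicator 1 (X e ω) *
    expNeg (∑' n, if n = e then 0 else f ‖X e ω‖ (X n ω))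

/-- `E ∑ₑ 1{s < ‖Xₑ‖ ≤ t} exp (- ∑_{n ≠ e} f_{‖Xₑ‖}(Xₙ))`. -/
noncomputable def palm (μ : Measure Ω) (X : ℕ → Ω → Plane) (f : ℝ → Plane → ℝ≥0∞) (s t : ℝ) :
    ℝ≥0∞ := ∫⁻ ω, ∑' e, palmTerm X f s t e ω ∂μ

theorem measurable_palmTerm (hX : ∀ n, Measurable (X n)) {f : ℝ → Plane → ℝ≥0∞}
    (hf : Measurable (Function.uncurry f)) (s t : ℝ) (e : ℕ) : Measurable (palmTerm X f s t e) := by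
  refine ((measurable_one.indicator (measurableSet_annulus s t)).comp (hX e)).mul
    (measurable_expNeg.comp (Measurable.tsum fun n => ?_))
  by_cases hn : n = e
  · simp [hn]
  · simp only [hn, if_false]
    exact hf.comp ((hX e).norm.prodMk (hX n))

theorem palm_eq_tsum (hX : ∀ n, Measurable (X n)) {f : ℝ → Plane → ℝ≥0∞}
    (hf : Measurable (Function.uncurry f)) (s t : ℝ) :
    palm μ X f s t = ∑' e, ∫⁻ ω, palmTerm X f s t e ω ∂μ :=
  lintegral_tsum fun e => (measurable_palmTerm hX hf s t e).aemeasurable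

theorem palm_add (hX : ∀ n, Measurable (X n)) {f : ℝ → Plane → ℝ≥0∞}
    (hf : Measurable (Function.uncurry f)) {r s t : ℝ} (hrs : r ≤ s) (hst : s ≤ t) :
    palm μ X f r t = palm μ X f r s + palm μ X f s t := by
  rw [palm, palm, palm, ← lintegral_add_left
    (Measurable.tsum fun e => measurable_palmTerm hX hf r s e)]
  refine lintegral_congr fun ω => ?_
  rw [← ENNReal.tsum_add]
  refine tsum_congr fun e => ?_
  rw [palmTerm, palmTerm, palmTerm, ← add_mul]
  congr 1
  have hd : Disjoint (annulus r s) (annulus s t) := by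
    rw [Set.disjoint_left]; intro x hx hy; exact absurd hx.2 (not_le.2 hy.1)
  have hu : annulus r t = annulus r s ∪ annulus s t := by
    ext x
    simp only [annulus, mem_union, mem_ofPred_eq]
    constructor
    · rintro ⟨h1, h2⟩
      rcases le_or_gt ‖x‖ s with h | h
      · exact Or.inl ⟨h1, h⟩
      · exact Or.inr ⟨h, h2⟩
    · rintro (⟨h1, h2⟩ | ⟨h1, h2⟩)
      · exact ⟨h1, h2.trans hst⟩
      · exact ⟨hrs.trans_lt h1, h2⟩
  rw [hu, indicator_union_of_disjoint hd]

theorem palm_le (hX : IsPoissonProcess μ lam X) (hlam : 0 ≤ lam) {f : ℝ → Plane → ℝ≥0∞}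
    {s t : ℝ} (hs : 0 ≤ s) (hst : s ≤ t) :
    palm μ X f s t ≤ ENNReal.ofReal (lam * Real.pi * (t ^ 2 - s ^ 2)) := by
  have hv := volume_annulus hs hst
  calc palm μ X f s t ≤ ∫⁻ ω, (pointCount X (annulus s t) ω : ℕ∞) ∂μ := by
        refine lintegral_mono fun ω => ?_
        simp only [pointCount_eq_tsum]
        exact ENNReal.tsum_le_tsum fun e => mul_le_of_le_one_right zero_le (expNeg_le_one _)
    _ = _ := by
        rw [hX.lintegral_pointCount hlam (measurableSet_annulus s t) (by rw [hv]; simp), hv,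
          ← ENNReal.ofReal_mul hlam, mul_assoc]

/-- Lowering the test function to radius `s` and ignoring the points inside the annulus can only
increase the functional. What remains is a count times a Laplace functional on a disjoint set, and
these factor. The last exponential is the price of removing the annulus from the exponent. -/
theorem palm_le_mul_expNeg (hX : IsPoissonProcess μ lam X) (hlam : 0 ≤ lam)
    {f : ℝ → Plane → ℝ≥0∞} (hf : Measurable (Function.uncurry f)) (hmono : MonotoneOn f (Ici 0))
    {s t : ℝ} (hs : 0 ≤ s) (hst : s ≤ t) :
    palm μ X f s t ≤ ENNReal.ofReal (lam * Real.pi * (t ^ 2 - s ^ 2)) *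
      (expNeg (ENNReal.ofReal lam * ∫⁻ x, (1 - expNeg (f s x))) *
        ENNReal.ofReal (Real.exp (lam * Real.pi * (t ^ 2 - s ^ 2)))) := by
  set A := annulus s t with hAdef
  have hA : MeasurableSet A := measurableSet_annulus s t
  have hv : volume A = ENNReal.ofReal (Real.pi * (t ^ 2 - s ^ 2)) := volume_annulus hs hst
  have hAv : volume A ≠ ⊤ := by rw [hv]; simp
  have hts : 0 ≤ t ^ 2 - s ^ 2 := by nlinarith
  set g : Plane → ℝ≥0∞ := Aᶜ.indicator (f s) with hg
  have hgm : Measurable g := (hf.comp measurable_prodMk_left).indicator hA.compl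
  have hgA : ∀ x ∈ A, g x = 0 := fun x hx => by simp [hg, hx]
  have hcount : ∫⁻ ω, (pointCount X A ω : ℕ∞) ∂μ =
      ENNReal.ofReal (lam * Real.pi * (t ^ 2 - s ^ 2)) := by
    rw [hX.lintegral_pointCount hlam hA hAv, hv, ← ENNReal.ofReal_mul hlam, mul_assoc]
  have h1 : palm μ X f s t ≤
      ∫⁻ ω, (pointCount X A ω : ℕ∞) * expNeg (∑' n, g (X n ω)) ∂μ := by
    refine lintegral_mono fun ω => ?_
    simp only [pointCount_eq_tsum]
    rw [← ENNReal.tsum_mul_right]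
    refine ENNReal.tsum_le_tsum fun e => ?_
    by_cases he : X e ω ∈ A
    · refine mul_le_mul_right (antitone_expNeg (ENNReal.tsum_le_tsum fun n => ?_)) _
      by_cases hn : n = e
      · subst hn; simp [hgA _ he]
      · simp only [hn, if_false]
        exact (indicator_le_self _ _ _).trans (hmono hs (norm_nonneg _) he.1.le _)
    · simp [palmTerm, ← hAdef, he]
  refine h1.trans ?_
  rw [hX.lintegral_mul_expNeg_tsum hlam hA (fun n => (n : ℝ≥0∞)) (by rw [hcount]; simp) hgm hgA,
    hcount]
  refine mul_le_mul_right ?_ _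
  -- The integrand is at most `1`, so restoring the annulus adds at most `lam` times its area.
  have h2 : ENNReal.ofReal lam * ∫⁻ x, (1 - expNeg (f s x)) ≤
      ENNReal.ofReal lam * (∫⁻ x, (1 - expNeg (g x))) +
        ENNReal.ofReal (lam * Real.pi * (t ^ 2 - s ^ 2)) := by
    rw [mul_assoc lam, ENNReal.ofReal_mul hlam, ← hv, ← mul_add]
    refine mul_le_mul_right ?_ _
    rw [← lintegral_indicator_one hA, ← lintegral_add_right _ (measurable_one.indicator hA)]
    refine lintegral_mono fun x => ?_
    by_cases hx : x ∈ A
    · simp only [hx, indicator_of_mem, Pi.one_apply]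
      exact tsub_le_self.trans le_add_self
    · simp [hg, hx]
  have h3 := antitone_expNeg h2
  rw [expNeg_add, expNeg_ofReal (by positivity)] at h3
  calc expNeg (ENNReal.ofReal lam * ∫⁻ x, (1 - expNeg (g x)))
      = expNeg (ENNReal.ofReal lam * ∫⁻ x, (1 - expNeg (g x))) *
        (ENNReal.ofReal (Real.exp (-(lam * Real.pi * (t ^ 2 - s ^ 2)))) *
          ENNReal.ofReal (Real.exp (lam * Real.pi * (t ^ 2 - s ^ 2)))) := by
        rw [← ENNReal.ofReal_mul (Real.exp_pos _).le, ← Real.exp_add]; simp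
    _ ≤ _ := by
        rw [← mul_assoc]
        exact mul_le_mul_left h3 _

/-- Only the event of exactly one point in the annulus is kept. Raising the test function to radius
`t` then decreases the functional and makes it independent of that point. -/
theorem le_palm (hX : IsPoissonProcess μ lam X) (hlam : 0 ≤ lam)
    {f : ℝ → Plane → ℝ≥0∞} (hf : Measurable (Function.uncurry f)) (hmono : MonotoneOn f (Ici 0))
    {s t : ℝ} (hs : 0 ≤ s) (hst : s ≤ t) :
    ENNReal.ofReal (lam * Real.pi * (t ^ 2 - s ^ 2) *
        Real.exp (-(lam * Real.pi * (t ^ 2 - s ^ 2)))) *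
      expNeg (ENNReal.ofReal lam * ∫⁻ x, (1 - expNeg (f t x))) ≤ palm μ X f s t := by
  set A := annulus s t with hAdef
  have hA : MeasurableSet A := measurableSet_annulus s t
  have hts : 0 ≤ t ^ 2 - s ^ 2 := by nlinarith
  have hv : volume A = ENNReal.ofReal (Real.pi * (t ^ 2 - s ^ 2)) := volume_annulus hs hst
  have hvr : volume.real A = Real.pi * (t ^ 2 - s ^ 2) := by
    rw [measureReal_def, hv, ENNReal.toReal_ofReal (by positivity)]
  have hAv : volume A ≠ ⊤ := by rw [hv]; simp
  set g : Plane → ℝ≥0∞ := Aᶜ.indicator (f t) with hg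
  have hgm : Measurable g := (hf.comp measurable_prodMk_left).indicator hA.compl
  have hgA : ∀ x ∈ A, g x = 0 := fun x hx => by simp [hg, hx]
  have hcount := hX.lintegral_count_eq_one hlam hA hAv
  rw [hvr, ← mul_assoc] at hcount
  have h1 : ∫⁻ ω, ({1} : Set ℕ∞).indicator 1 (pointCount X A ω) * expNeg (∑' n, g (X n ω)) ∂μ ≤
      palm μ X f s t := by
    refine lintegral_mono fun ω => ?_
    by_cases h : pointCount X A ω = 1
    · obtain ⟨e, he⟩ := encard_eq_one.1 h
      have hmem : ∀ n, X n ω ∈ A ↔ n = e := fun n => by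
        rw [← mem_singleton_iff, ← he]; rfl
      have heA : X e ω ∈ A := (hmem e).2 rfl
      refine le_trans ?_ (ENNReal.le_tsum e)
      simp only [h, mem_singleton_iff, indicator_of_mem, Pi.one_apply, palmTerm, ← hAdef, heA]
      rw [one_mul, one_mul]
      refine antitone_expNeg (ENNReal.tsum_le_tsum fun n => ?_)
      by_cases hn : n = e
      · simp [hn]
      · have hnA : X n ω ∈ Aᶜ := fun h' => hn ((hmem n).1 h')
        simp only [hn, if_false, hg, indicator_of_mem hnA]
        exact hmono (norm_nonneg _) (hs.trans hst) heA.2 _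
    · simp [h]
  refine le_trans ?_ h1
  rw [hX.lintegral_mul_expNeg_tsum hlam hA _ (by rw [hcount]; simp) hgm hgA, hcount]
  refine mul_le_mul_right (antitone_expNeg (mul_le_mul_right (lintegral_mono fun x => ?_) _)) _
  exact tsub_le_tsub_left (antitone_expNeg (indicator_le_self _ _ _)) _

/-- A Campbell-Mecke formula for radially monotone multiplicative functionals. -/
theorem palm_eq_integral (hX : IsPoissonProcess μ lam X) (hlam : 0 ≤ lam)
    {f : ℝ → Plane → ℝ≥0∞} (hf : Measurable (Function.uncurry f)) (hmono : MonotoneOn f (Ici 0))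
    {D : ℝ} (hD : 0 ≤ D) {K : ℝ → ℝ} (hK : ContinuousOn K (Ici D))
    (hKf : ∀ r, D ≤ r → K r = (expNeg (ENNReal.ofReal lam * ∫⁻ x, (1 - expNeg (f r x)))).toReal)
    {t : ℝ} (ht : D ≤ t) :
    (palm μ X f D t).toReal = ∫ r in D..t, 2 * (lam * Real.pi) * r * K r := by
  have hfin : ∀ s t, D ≤ s → s ≤ t → palm μ X f s t ≠ ⊤ := fun s t hs hst =>
    ne_top_of_le_ne_top ENNReal.ofReal_ne_top (palm_le hX hlam (hD.trans hs) hst)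
  have hinc : ∀ s t, D ≤ s → s ≤ t →
      (palm μ X f D t).toReal - (palm μ X f D s).toReal = (palm μ X f s t).toReal := by
    intro s t hs hst
    rw [palm_add hX.measurable_point hf hs hst,
      ENNReal.toReal_add (hfin _ _ le_rfl hs) (hfin _ _ hs hst)]
    ring
  have hc : ∀ s t, D ≤ s → s ≤ t → 0 ≤ lam * Real.pi * (t ^ 2 - s ^ 2) := by
    intro s t hs hst
    have : 0 ≤ t ^ 2 - s ^ 2 := by nlinarith
    positivity
  refine eq_integral_of_increment_bounds (f := fun t => (palm μ X f D t).toReal)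
    hK ?_ ?_ ?_ ?_ ?_ ht
  · have h := palm_le (f := f) hX hlam hD le_rfl (t := D)
    simp only [sub_self, mul_zero, ENNReal.ofReal_zero, nonpos_iff_eq_zero] at h
    simp [h]
  · intro s t hs hst
    rw [← sub_nonneg, hinc s t hs hst]
    exact ENNReal.toReal_nonneg
  · intro s t hs hst
    simp only [hinc s t hs hst]
    exact ENNReal.toReal_le_of_le_ofReal (hc s t hs hst) (palm_le hX hlam (hD.trans hs) hst)
  · intro s t hs hst
    simp only [hinc s t hs hst, hKf s hs]
    have h := ENNReal.toReal_mono (by simp [ENNReal.mul_eq_top, expNeg_ne_top])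
      (palm_le_mul_expNeg hX hlam hf hmono (hD.trans hs) hst)
    rwa [ENNReal.toReal_mul, ENNReal.toReal_mul, ENNReal.toReal_ofReal (hc s t hs hst),
      ENNReal.toReal_ofReal (Real.exp_pos _).le] at h
  · intro s t hs hst
    simp only [hinc s t hs hst, hKf t (hs.trans hst)]
    have h := ENNReal.toReal_mono (hfin s t hs hst) (le_palm hX hlam hf hmono (hD.trans hs) hst)
    rwa [ENNReal.toReal_mul, ENNReal.toReal_ofReal
      (mul_nonneg (hc s t hs hst) (Real.exp_pos _).le)] at h

end Palm

/-! ### Radial integrals as beta and hypergeometric functions. -/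

theorem setIntegral_lt_setIntegral {f g : ℝ → ℝ} {s : Set ℝ} (hs : MeasurableSet s)
    (hs0 : volume s ≠ 0) (hf : IntegrableOn f s) (hg : IntegrableOn g s)
    (h : ∀ x ∈ s, f x < g x) : ∫ x in s, f x < ∫ x in s, g x := by
  rw [← sub_pos, ← integral_sub hg hf]
  refine (setIntegral_pos_iff_support_of_nonneg_ae ?_ (hg.sub hf)).2 ?_
  rotate_left
  · refine (pos_iff_ne_zero.2 hs0).trans_le (measure_mono fun x hx => ⟨?_, hx⟩)
    exact (sub_pos.2 (h x hx)).ne'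
  · filter_upwards [ae_restrict_mem hs] with x hx
    exact (sub_pos.2 (h x hx)).le

theorem beta_one_right {b : ℝ} (hb : 0 < b) : beta b 1 = b⁻¹ := by
  rw [beta, Real.Gamma_one, Real.Gamma_add_one hb.ne']
  have := (Real.Gamma_pos_of_pos hb).ne'
  field_simp

theorem gaussHyp_one_add_one {b : ℝ} (hb : 0 < b) (x : ℝ) :
    gaussHyp 1 b (b + 1) x = b * ∫ t in Ioc (0 : ℝ) 1, t ^ (b - 1) * (1 - x * t)⁻¹ := by
  rw [gaussHyp, add_sub_cancel_left, beta_one_right hb, inv_inv,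
    intervalIntegral.integral_of_le zero_le_one]
  simp [Real.rpow_neg_one]

theorem integrableOn_rpow_mul_inv {b x : ℝ} (hb : 0 < b) (hx : x ≤ 0) :
    IntegrableOn (fun t : ℝ => t ^ (b - 1) * (1 - x * t)⁻¹) (Ioc 0 1) := by
  rw [← integrableOn_Icc_iff_integrableOn_Ioc]
  refine IntegrableOn.mul_continuousOn ?_ ?_ isCompact_Icc
  · rw [integrableOn_Icc_iff_integrableOn_Ioc,
      ← intervalIntegrable_iff_integrableOn_Ioc_of_le zero_le_one]
    exact intervalIntegral.intervalIntegrable_rpow' (by linarith)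
  · refine ContinuousOn.inv₀ (by fun_prop) fun t ht => ?_
    nlinarith [ht.1]

/-- The Euler kernel `t^(b-1) / (1 - x t)` is strictly increasing in `x` for every `t` in `(0, 1]`.
This is the source of the strict secrecy bound. -/
theorem gaussHyp_one_lt {b x y : ℝ} (hb : 0 < b) (hxy : x < y) (hy : y ≤ 0) :
    gaussHyp 1 b (b + 1) x < gaussHyp 1 b (b + 1) y := by
  rw [gaussHyp_one_add_one hb, gaussHyp_one_add_one hb]
  refine mul_lt_mul_of_pos_left (setIntegral_lt_setIntegral measurableSet_Ioc (by simp)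
    (integrableOn_rpow_mul_inv hb (hxy.le.trans hy)) (integrableOn_rpow_mul_inv hb hy)
    fun t ht => ?_) hb
  refine mul_lt_mul_of_pos_left ?_ (Real.rpow_pos_of_pos ht.1 _)
  refine inv_strictAnti₀ ?_ ?_
  · nlinarith [ht.1]
  · nlinarith [ht.1]

section Substitution

variable {δ c : ℝ}

/-- The substitution `y = c t / (1 - t)` carries `(0, 1)` onto `(0, ∞)` and turns the kernel
`y^(δ-1) c / (y + c)` into a beta kernel. -/
theorem hasDerivWithinAt_odds (c : ℝ) {t : ℝ} (ht : t ∈ Ioo (0 : ℝ) 1) :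
    HasDerivWithinAt (fun t => c * t / (1 - t)) (c / (1 - t) ^ 2) (Ioo 0 1) t := by
  have h1 : (1 : ℝ) - t ≠ 0 := by linarith [ht.2]
  have h := (((hasDerivAt_id t).const_mul c).div ((hasDerivAt_id t).const_sub 1) h1)
  refine HasDerivAt.hasDerivWithinAt (h.congr_deriv ?_)
  simp only [id]
  congr 1
  ring

theorem injOn_odds (hc : 0 < c) : InjOn (fun t : ℝ => c * t / (1 - t)) (Ioo 0 1) := by
  intro x hx y hy h
  have hx1 : (1 : ℝ) - x ≠ 0 := by linarith [hx.2]
  have hy1 : (1 : ℝ) - y ≠ 0 := by linarith [hy.2]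
  simp only at h
  rw [div_eq_div_iff hx1 hy1] at h
  have : c * (x - y) = 0 := by linarith
  rcases mul_eq_zero.1 this with h | h <;> linarith

theorem image_odds (hc : 0 < c) : (fun t : ℝ => c * t / (1 - t)) '' Ioo 0 1 = Ioi 0 := by
  ext y
  constructor
  · rintro ⟨t, ht, rfl⟩
    exact div_pos (mul_pos hc ht.1) (by linarith [ht.2])
  · intro hy
    have hy : 0 < y := hy
    have hyc : 0 < y + c := by linarith
    refine ⟨y / (y + c), ⟨by positivity, (div_lt_one hyc).2 (by linarith)⟩, ?_⟩
    have h : 1 - y / (y + c) = c / (y + c) := by field_simp; ring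
    simp only [h]
    field_simp

theorem odds_integrand (hc : 0 < c) {t : ℝ} (ht : t ∈ Ioo (0 : ℝ) 1) :
    |c / (1 - t) ^ 2| • ((c * t / (1 - t)) ^ (δ - 1) * (c / (c * t / (1 - t) + c))) =
      c ^ δ * (t ^ (δ - 1) * (1 - t) ^ ((1 - δ) - 1)) := by
  have h0 : 0 < t := ht.1
  have h1 : 0 < 1 - t := by linarith [ht.2]
  have h4 : (1 - t) ^ ((1 - δ) - 1) = ((1 - t) ^ (δ - 1))⁻¹ / (1 - t) := by
    rw [← Real.rpow_neg h1.le, ← Real.rpow_sub_one h1.ne']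
    congr 1; ring
  rw [abs_of_pos (by positivity), smul_eq_mul, Real.div_rpow (by positivity) h1.le,
    Real.mul_rpow hc.le h0.le, h4, show c ^ δ = c ^ (δ - 1) * c by
      rw [Real.rpow_sub_one hc.ne']; field_simp]
  have h2 := (Real.rpow_pos_of_pos h1 (δ - 1)).ne'
  have h3 : c * t / (1 - t) + c = c / (1 - t) := by field_simp; ring
  rw [h3]
  field_simp

theorem integrableOn_stieltjes (hδ0 : 0 < δ) (hδ1 : δ < 1) (hc : 0 < c) :
    IntegrableOn (fun y : ℝ => y ^ (δ - 1) * (c / (y + c))) (Ioi 0) := by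
  rw [← image_odds hc, integrableOn_image_iff_integrableOn_abs_deriv_smul measurableSet_Ioo
    (fun t ht => hasDerivWithinAt_odds c ht) (injOn_odds hc)]
  refine IntegrableOn.congr_fun ?_ (fun t ht => (odds_integrand (δ := δ) hc ht).symm)
    measurableSet_Ioo
  exact ((integrable_betaKernel hδ0 (sub_pos.2 hδ1)).mono_set Ioo_subset_Ioc_self).const_mul _

theorem integral_stieltjes (hδ0 : 0 < δ) (hδ1 : δ < 1) (hc : 0 < c) :
    ∫ y in Ioi (0 : ℝ), y ^ (δ - 1) * (c / (y + c)) = c ^ δ * beta (1 - δ) δ := by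
  rw [← image_odds hc, integral_image_eq_integral_abs_deriv_smul measurableSet_Ioo
    (fun t ht => hasDerivWithinAt_odds c ht) (injOn_odds hc),
    setIntegral_congr_fun measurableSet_Ioo (fun t ht => odds_integrand (δ := δ) hc ht),
    integral_const_mul, ← integral_Ioc_eq_integral_Ioo,
    integral_betaKernel hδ0 (sub_pos.2 hδ1), beta, beta, mul_comm (Real.Gamma δ), add_comm δ]

/-- The inversion `y = a / t` maps the tail to `(0, 1)` and produces the Euler integral with
exponent `1 - δ`. -/
theorem integral_stieltjes_Ioi (hδ1 : δ < 1) {a γ : ℝ} (ha : 0 < a) (hγ : 0 < γ) :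
    ∫ y in Ioi a, y ^ (δ - 1) * (γ * a / (y + γ * a)) =
      a ^ δ * (γ / (1 - δ) * gaussHyp 1 (1 - δ) (2 - δ) (-γ)) := by
  have himg : (fun t : ℝ => a / t) '' Ioo 0 1 = Ioi a := by
    ext y
    constructor
    · rintro ⟨t, ht, rfl⟩
      exact (lt_div_iff₀ ht.1).2 (by nlinarith [ht.1, ht.2])
    · intro hy
      have hy : a < y := hy
      have hy0 : 0 < y := ha.trans hy
      exact ⟨a / y, ⟨by positivity, (div_lt_one hy0).2 hy⟩, by field_simp⟩
  have hd : ∀ t ∈ Ioo (0 : ℝ) 1,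
      HasDerivWithinAt (fun t : ℝ => a / t) (-a / t ^ 2) (Ioo 0 1) t := by
    intro t ht
    have h := (hasDerivAt_inv ht.1.ne').const_mul a
    refine HasDerivAt.hasDerivWithinAt ?_
    simp only [div_eq_mul_inv] at h ⊢
    exact h.congr_deriv (by ring)
  have hinj : InjOn (fun t : ℝ => a / t) (Ioo 0 1) := by
    intro x hx y hy h
    simp only at h
    rw [div_eq_div_iff hx.1.ne' hy.1.ne'] at h
    exact (mul_left_cancel₀ ha.ne' h).symm
  have hpt : ∀ t ∈ Ioo (0 : ℝ) 1,
      |-a / t ^ 2| • ((a / t) ^ (δ - 1) * (γ * a / (a / t + γ * a))) =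
      (a ^ δ * γ) * (t ^ ((1 - δ) - 1) * (1 - (-γ) * t)⁻¹) := by
    intro t ht
    have h0 : 0 < t := ht.1
    have h2 := (Real.rpow_pos_of_pos h0 (δ - 1)).ne'
    have h4 : 0 < 1 + γ * t := by positivity
    have h3 : a / t + γ * a = a * (1 + γ * t) / t := by field_simp
    have h5 : t ^ ((1 - δ) - 1) = (t ^ (δ - 1))⁻¹ / t := by
      rw [← Real.rpow_neg h0.le, ← Real.rpow_sub_one h0.ne']
      congr 1; ring
    rw [h3, abs_div, abs_neg, abs_of_pos ha, abs_of_pos (by positivity : 0 < t ^ 2), smul_eq_mul,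
      Real.div_rpow ha.le h0.le, h5, show a ^ δ = a ^ (δ - 1) * a by
        rw [Real.rpow_sub_one ha.ne']; field_simp, neg_mul, sub_neg_eq_add]
    field_simp
  rw [← himg, integral_image_eq_integral_abs_deriv_smul measurableSet_Ioo hd hinj,
    setIntegral_congr_fun measurableSet_Ioo hpt, integral_const_mul, ← integral_Ioc_eq_integral_Ioo,
    show 2 - δ = (1 - δ) + 1 by ring, gaussHyp_one_add_one (sub_pos.2 hδ1)]
  have : (1 : ℝ) - δ ≠ 0 := by linarith
  field_simp

theorem integral_stieltjes_Ioc (hδ0 : 0 < δ) {a : ℝ} (ha : 0 < a) (hc : 0 < c) :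
    ∫ y in Ioc 0 a, y ^ (δ - 1) * (c / (y + c)) =
      a ^ δ * (δ⁻¹ * gaussHyp 1 δ (δ + 1) (-(a / c))) := by
  have h := intervalIntegral.integral_comp_mul_left (a := 0) (b := 1)
    (fun y : ℝ => y ^ (δ - 1) * (c / (y + c))) ha.ne'
  rw [mul_zero, mul_one, intervalIntegral.integral_of_le zero_le_one,
    intervalIntegral.integral_of_le ha.le] at h
  have hpt : ∀ t ∈ Ioc (0 : ℝ) 1, (a * t) ^ (δ - 1) * (c / (a * t + c)) =
      a ^ (δ - 1) * (t ^ (δ - 1) * (1 - (-(a / c)) * t)⁻¹) := by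
    intro t ht
    have h0 : 0 < t := ht.1
    rw [Real.mul_rpow ha.le h0.le]
    have : 1 - (-(a / c)) * t = (a * t + c) / c := by field_simp; ring
    rw [this, inv_div]
    ring
  rw [setIntegral_congr_fun measurableSet_Ioc hpt, integral_const_mul, smul_eq_mul,
    eq_inv_mul_iff_mul_eq₀ ha.ne'] at h
  rw [← h, gaussHyp_one_add_one hδ0, show a ^ δ = a ^ (δ - 1) * a by
        rw [Real.rpow_sub_one ha.ne']; field_simp, inv_mul_cancel_left₀ hδ0.ne']
  ring

end Substitution

section Radial

variable {α γ r : ℝ}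

/-- The substitution is `y = ρ^α`; the exponent `2/α - 1` accounts for the planar weight `ρ dρ`. -/
theorem integral_radial_Ioi (hα : 2 < α) {c a : ℝ} (ha : 0 ≤ a) :
    ∫ ρ in Ioi a, ρ * (c / (ρ ^ α + c)) =
      α⁻¹ * ∫ y in Ioi (a ^ α), y ^ (2 / α - 1) * (c / (y + c)) := by
  have hα0 : 0 < α := by linarith
  rw [← integral_comp_rpow_Ioi_of_pos' hα0 (Real.rpow_nonneg ha α), Real.rpow_rpow_inv ha hα0.ne',
    ← integral_const_mul]
  refine setIntegral_congr_fun measurableSet_Ioi fun ρ hρ => ?_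
  have hρ0 : 0 < ρ := lt_of_le_of_lt ha hρ
  have h1 : ρ = ρ ^ (α - 1) * (ρ ^ α) ^ (2 / α - 1) := by
    rw [← Real.rpow_mul hρ0.le, ← Real.rpow_add hρ0]
    have : α - 1 + α * (2 / α - 1) = 1 := by field_simp; ring
    rw [this, Real.rpow_one]
  simp only [smul_eq_mul]
  nth_rewrite 1 [h1]
  field_simp

theorem integrableOn_radial (hα : 2 < α) {c : ℝ} (hc : 0 < c) :
    IntegrableOn (fun ρ => ρ * (c / (ρ ^ α + c))) (Ioi 0) := by
  have hα0 : 0 < α := by linarith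
  have h := (integrableOn_Ioi_comp_rpow_iff
    (fun y : ℝ => y ^ (2 / α - 1) * (c / (y + c))) hα0.ne').2
    (integrableOn_stieltjes (by positivity) ((div_lt_one hα0).2 hα) hc)
  refine IntegrableOn.congr_fun (h.const_mul α⁻¹) (fun ρ hρ => ?_) measurableSet_Ioi
  have hρ0 : 0 < ρ := hρ
  have h1 : ρ = ρ ^ (α - 1) * (ρ ^ α) ^ (2 / α - 1) := by
    rw [← Real.rpow_mul hρ0.le, ← Real.rpow_add hρ0]
    have : α - 1 + α * (2 / α - 1) = 1 := by field_simp; ring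
    rw [this, Real.rpow_one]
  simp only [smul_eq_mul, abs_of_pos hα0]
  nth_rewrite 4 [h1]
  field_simp

theorem rpow_rpow_two_div (hα : 2 < α) (hr : 0 ≤ r) : (r ^ α) ^ (2 / α) = r ^ 2 := by
  rw [← Real.rpow_mul hr, mul_div_cancel₀ _ (by linarith : α ≠ 0), Real.rpow_two]

theorem integral_radial (hα : 2 < α) (hγ : 0 < γ) (hr : 0 < r) :
    ∫ ρ in Ioi (0 : ℝ), ρ * (γ * r ^ α / (ρ ^ α + γ * r ^ α)) = r ^ 2 * kappa1 α γ / 2 := by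
  have hα0 : 0 < α := by linarith
  have hrα : 0 < r ^ α := Real.rpow_pos_of_pos hr α
  rw [integral_radial_Ioi hα le_rfl, Real.zero_rpow hα0.ne',
    integral_stieltjes (by positivity) ((div_lt_one hα0).2 hα) (by positivity), kappa1,
    Real.mul_rpow hγ.le hrα.le, rpow_rpow_two_div hα hr.le]
  field_simp

theorem integral_radial_Ioi_eq (hα : 2 < α) (hγ : 0 < γ) (hr : 0 < r) :
    ∫ ρ in Ioi r, ρ * (γ * r ^ α / (ρ ^ α + γ * r ^ α)) = r ^ 2 * kappa2 α γ / 2 := by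
  have hα0 : 0 < α := by linarith
  have hrα : 0 < r ^ α := Real.rpow_pos_of_pos hr α
  rw [integral_radial_Ioi hα hr.le, integral_stieltjes_Ioi ((div_lt_one hα0).2 hα) hrα hγ, kappa2,
    rpow_rpow_two_div hα hr.le]
  field_simp

/-- The power substitution is at hand on half-lines, so the bounded interval is the difference of
the half-lines from `0` and from `D`, before and after the substitution. -/
theorem integral_radial_Ioc {D : ℝ} (hα : 2 < α) (hγ : 0 < γ) (hr : 0 < r) (hD : 0 < D) :
    ∫ ρ in Ioc 0 D, ρ * (γ * r ^ α / (ρ ^ α + γ * r ^ α)) =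
      D ^ 2 * gaussHyp 1 (2 / α) (2 / α + 1) (-(D ^ α / (γ * r ^ α))) / 2 := by
  have hα0 : 0 < α := by linarith
  have hδ0 : 0 < 2 / α := by positivity
  have hδ1 : 2 / α < 1 := (div_lt_one hα0).2 hα
  have hrα : 0 < r ^ α := Real.rpow_pos_of_pos hr α
  have hDα : 0 < D ^ α := Real.rpow_pos_of_pos hD α
  have hc : 0 < γ * r ^ α := by positivity
  have h1 := setIntegral_union (Ioc_disjoint_Ioi le_rfl) measurableSet_Ioi
    ((integrableOn_radial hα hc).mono_set (fun x hx => hx.1 : Ioc 0 D ⊆ Ioi 0))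
    ((integrableOn_radial hα hc).mono_set (Ioi_subset_Ioi hD.le))
  have h2 := setIntegral_union (Ioc_disjoint_Ioi le_rfl) measurableSet_Ioi
    ((integrableOn_stieltjes hδ0 hδ1 hc).mono_set (fun x hx => hx.1 : Ioc 0 (D ^ α) ⊆ Ioi 0))
    ((integrableOn_stieltjes hδ0 hδ1 hc).mono_set (Ioi_subset_Ioi hDα.le))
  rw [Ioc_union_Ioi_eq_Ioi hD.le, integral_radial_Ioi hα le_rfl, integral_radial_Ioi hα hD.le,
    Real.zero_rpow hα0.ne'] at h1
  rw [Ioc_union_Ioi_eq_Ioi hDα.le, integral_stieltjes_Ioc hδ0 hDα hc, rpow_rpow_two_div hα hD.le]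
    at h2
  rw [h2, mul_add, add_left_inj] at h1
  rw [← h1]
  field_simp

/-- `κ₁(γ) = κ₂(γ) + ₂F₁(1, δ; δ + 1; -1/γ)`. -/
theorem kappa1_eq (hα : 2 < α) (hγ : 0 < γ) :
    kappa1 α γ = kappa2 α γ + gaussHyp 1 (2 / α) (2 / α + 1) (-(1 / γ)) := by
  have hc : 0 < γ * (1 : ℝ) ^ α := by simpa using hγ
  have h1 := setIntegral_union (Ioc_disjoint_Ioi le_rfl) measurableSet_Ioi
    ((integrableOn_radial hα hc).mono_set (fun x hx => hx.1 : Ioc (0 : ℝ) 1 ⊆ Ioi 0))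
    ((integrableOn_radial hα hc).mono_set (Ioi_subset_Ioi zero_le_one))
  rw [Ioc_union_Ioi_eq_Ioi zero_le_one, integral_radial hα hγ one_pos,
    integral_radial_Ioc hα hγ one_pos one_pos, integral_radial_Ioi_eq hα hγ one_pos] at h1
  simp only [one_pow, one_mul, Real.one_rpow, mul_one] at h1
  linarith

end Radial

/-! ### The law of a mark -/

/-- The mark of a station: file held, guard zone clear, fading gain. -/
abbrev Mark : Type := Bool × Bool × ℝ

/-- The law of a mark, when the first two components are `true` with probabilities `p` and `a`. -/
noncomputable def markLaw (p a : ℝ) : Measure Mark := (coin p).prod ((coin a).prod (expMeasure 1))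

/-- The marks of active stations. -/
def activeMarks : Set Mark := {z | z.1 = true ∧ z.2.1 = true}

theorem measurableSet_activeMarks : MeasurableSet activeMarks :=
  (measurable_fst (measurableSet_singleton true)).inter
    (measurable_snd.fst (measurableSet_singleton true))

instance (q : ℝ) : IsFiniteMeasure (coin q) := by
  unfold coin
  have h1 : IsFiniteMeasure (ENNReal.ofReal q • Measure.dirac true : Measure Bool) :=
    Measure.smul_finite _ ENNReal.ofReal_ne_top
  have h2 : IsFiniteMeasure (ENNReal.ofReal (1 - q) • Measure.dirac false : Measure Bool) :=
    Measure.smul_finite _ ENNReal.ofReal_ne_top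
  infer_instance

instance : IsProbabilityMeasure (expMeasure 1) := isProbabilityMeasure_expMeasure one_pos

theorem lintegral_coin (q : ℝ) (g : Bool → ℝ≥0∞) :
    ∫⁻ b, g b ∂coin q = ENNReal.ofReal q * g true + ENNReal.ofReal (1 - q) * g false := by
  simp [coin, lintegral_add_measure, lintegral_smul_measure]

theorem coin_true (q : ℝ) : coin q {true} = ENNReal.ofReal q := by
  simp [coin]

/-- Tilting the `Exp(1)` density by `exp (-c h)` gives `(1 + c)⁻¹` times the `Exp(1 + c)` density,
whose mass is `1`. -/
theorem lintegral_expNeg_expMeasure {c : ℝ} (hc : 0 ≤ c) :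
    ∫⁻ h, expNeg (ENNReal.ofReal (c * h)) ∂expMeasure 1 = ENNReal.ofReal (1 + c)⁻¹ := by
  have hc1 : 0 < 1 + c := by linarith
  have hmeas : Measurable fun h : ℝ => expNeg (ENNReal.ofReal (c * h)) := by fun_prop
  have hd : expMeasure 1 = volume.withDensity (exponentialPDF 1) := rfl
  have hmd : Measurable (exponentialPDF 1) := (measurable_exponentialPDFReal 1).ennreal_ofReal
  rw [hd, lintegral_withDensity_eq_lintegral_mul _ hmd hmeas]
  have hpt : ∀ h : ℝ, (exponentialPDF 1 * fun h => expNeg (ENNReal.ofReal (c * h))) h =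
      ENNReal.ofReal (1 + c)⁻¹ * exponentialPDF (1 + c) h := by
    intro h
    rw [Pi.mul_apply]
    rcases lt_or_ge h 0 with h0 | h0
    · simp [exponentialPDF_of_neg h0]
    · rw [exponentialPDF_of_nonneg h0, exponentialPDF_of_nonneg h0, expNeg_ofReal (by positivity),
        ← ENNReal.ofReal_mul (by positivity), ← ENNReal.ofReal_mul (by positivity)]
      congr 1
      rw [inv_mul_cancel_left₀ hc1.ne', one_mul, ← Real.exp_add]
      congr 1; ring
  simp_rw [hpt]
  have hmd' : Measurable (exponentialPDF (1 + c)) :=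
    (measurable_exponentialPDFReal _).ennreal_ofReal
  rw [lintegral_const_mul _ hmd', lintegral_exponentialPDF_eq_one hc1, mul_one]

instance : NullSingletonClass (expMeasure 1) :=
  nullSingletonClass_withDensity (μ := volume) (exponentialPDF 1)

theorem expMeasure_Iic {t : ℝ} (ht : 0 ≤ t) :
    expMeasure 1 (Iic t) = ENNReal.ofReal (1 - Real.exp (-t)) := by
  rw [← ofReal_cdf, cdf_expMeasure_eq one_pos, if_pos ht, one_mul]

/-- Infinite thresholds are included, since the total cost of the other stations may be `∞`. -/
theorem expMeasure_tail (s : ℝ≥0∞) : expMeasure 1 {h | s ≤ ENNReal.ofReal h} = expNeg s := by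
  induction s using ENNReal.recTopCoe with
  | top => simp
  | coe t =>
    rcases eq_or_lt_of_le (zero_le : 0 ≤ t) with h0 | h0
    · simp [← h0]
    · have hset : {h : ℝ | (t : ℝ≥0∞) ≤ ENNReal.ofReal h} = Ici (t : ℝ) := by
        ext h
        rw [mem_ofPred_eq, mem_Ici, ← ENNReal.ofReal_coe_nnreal]
        rw [ENNReal.ofReal_le_ofReal_iff']
        refine ⟨fun h' => h'.resolve_right (not_le.2 (by exact_mod_cast h0)), Or.inl⟩
      rw [hset, ← ENNReal.ofReal_coe_nnreal, expNeg_ofReal t.coe_nonneg, measure_congr Ioi_ae_eq_Ici.symm,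
        ← compl_Iic, prob_compl_eq_one_sub measurableSet_Iic, expMeasure_Iic t.coe_nonneg,
        ← ENNReal.ofReal_one, ← ENNReal.ofReal_sub _ (by simp [Real.exp_le_one_iff])]
      simp

theorem markLaw_active_tail (p a : ℝ) (hp : 0 ≤ p) (s : ℝ≥0∞) :
    markLaw p a {z | z ∈ activeMarks ∧ s ≤ ENNReal.ofReal z.2.2} =
      ENNReal.ofReal (p * a) * expNeg s := by
  have : {z : Mark | z ∈ activeMarks ∧ s ≤ ENNReal.ofReal z.2.2} =
      {true} ×ˢ ({true} ×ˢ {h | s ≤ ENNReal.ofReal h}) := by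
    ext z; simp [activeMarks, and_assoc]
  rw [this, markLaw, Measure.prod_prod, Measure.prod_prod, coin_true, coin_true, expMeasure_tail,
    ENNReal.ofReal_mul hp, mul_assoc]

theorem lintegral_markLaw (p a : ℝ) {g : Mark → ℝ≥0∞} (hg : Measurable g) :
    ∫⁻ z, g z ∂markLaw p a =
      ENNReal.ofReal p * (ENNReal.ofReal a * (∫⁻ h, g (true, true, h) ∂expMeasure 1) +
        ENNReal.ofReal (1 - a) * ∫⁻ h, g (true, false, h) ∂expMeasure 1) +
      ENNReal.ofReal (1 - p) * (ENNReal.ofReal a * (∫⁻ h, g (false, true, h) ∂expMeasure 1) +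
        ENNReal.ofReal (1 - a) * ∫⁻ h, g (false, false, h) ∂expMeasure 1) := by
  rw [markLaw, lintegral_prod _ hg.aemeasurable, lintegral_coin,
    lintegral_prod (fun y => g (true, y)) (hg.comp measurable_prodMk_left).aemeasurable,
    lintegral_prod (fun y => g (false, y)) (hg.comp measurable_prodMk_left).aemeasurable,
    lintegral_coin, lintegral_coin]

/-- The exponent `x` with `exp (-x) = 1 - q`. -/
noncomputable def thinExponent (q : ℝ) : ℝ≥0∞ :=
  if q < 1 then ENNReal.ofReal (-Real.log (1 - q)) else ⊤

/-- The case `q = 1`, with infinite exponent, does occur: every station is active when `p = 1` and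
`λₑ = 0`. -/
theorem expNeg_thinExponent {q : ℝ} (hq0 : 0 ≤ q) (hq1 : q ≤ 1) :
    expNeg (thinExponent q) = ENNReal.ofReal (1 - q) := by
  unfold thinExponent
  split_ifs with h
  · rw [expNeg_ofReal (neg_nonneg.2 (Real.log_nonpos (by linarith) (by linarith))), neg_neg,
      Real.exp_log (by linarith)]
  · have : q = 1 := le_antisymm hq1 (not_lt.1 h)
    simp [this]

theorem expNeg_log_one_add {c : ℝ} (hc : 0 ≤ c) :
    expNeg (ENNReal.ofReal (Real.log (1 + c))) = ENNReal.ofReal (1 + c)⁻¹ := by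
  rw [expNeg_ofReal (Real.log_nonneg (by linarith)), Real.exp_neg, Real.exp_log (by linarith)]

/-- Interference cost of a station with fading `z.2.2`; it is infinite if `b` holds and the station
is active. -/
theorem lintegral_expNeg_cost {p a c : ℝ} (hp0 : 0 ≤ p) (hp1 : p ≤ 1) (ha0 : 0 ≤ a) (ha1 : a ≤ 1)
    (hc : 0 ≤ c) (b : Prop) [Decidable b] [DecidablePred (· ∈ activeMarks)] :
    ∫⁻ z, expNeg (ENNReal.ofReal (c * z.2.2) + if z ∈ activeMarks ∧ b then ⊤ else 0)
        ∂markLaw p a =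
      expNeg (ENNReal.ofReal (Real.log (1 + c)) + if b then thinExponent (p * a) else 0) := by
  have hpa0 : 0 ≤ p * a := mul_nonneg hp0 ha0
  have hpa1 : p * a ≤ 1 := mul_le_one₀ hp1 ha0 ha1
  have hmeas : Measurable fun z : Mark =>
      expNeg (ENNReal.ofReal (c * z.2.2) + if z ∈ activeMarks ∧ b then ⊤ else 0) := by
    have h1 : Measurable fun z : Mark => ENNReal.ofReal (c * z.2.2) := by fun_prop
    have h2 : Measurable fun z : Mark => if z ∈ activeMarks ∧ b then (⊤ : ℝ≥0∞) else 0 :=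
      Measurable.ite (measurableSet_activeMarks.inter (MeasurableSet.const b)) measurable_const
        measurable_const
    exact measurable_expNeg.comp (h1.add h2)
  have hL := lintegral_expNeg_expMeasure hc
  have hL0 : (0 : ℝ) ≤ (1 + c)⁻¹ := by positivity
  have h1p : 0 ≤ 1 - p := by linarith
  have h1a : 0 ≤ 1 - a := by linarith
  rw [lintegral_markLaw p a hmeas, expNeg_add, expNeg_log_one_add hc]
  by_cases hb : b
  -- Active marks contribute `exp (-∞) = 0`; the other three mark classes have total mass `1 - p a`.
  · simp only [activeMarks, hb, mem_ofPred_eq, and_true, if_true, add_top, expNeg_top, add_zero,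
      lintegral_zero, mul_zero, zero_add, hL, expNeg_thinExponent hpa0 hpa1, Bool.false_eq_true,
      and_false, if_false]
    rw [← ENNReal.ofReal_mul h1a, ← ENNReal.ofReal_mul hp0, ← ENNReal.ofReal_mul ha0,
      ← ENNReal.ofReal_add (by positivity) (by positivity), ← ENNReal.ofReal_mul h1p,
      ← ENNReal.ofReal_add (by positivity) (by positivity), ← ENNReal.ofReal_mul hL0]
    congr 1; ring
  · simp only [hb, and_false, if_false, add_zero, hL, expNeg_zero, mul_one]
    rw [← ENNReal.ofReal_mul h1a, ← ENNReal.ofReal_mul ha0,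
      ← ENNReal.ofReal_add (by positivity) (by positivity), ← ENNReal.ofReal_mul hp0,
      ← ENNReal.ofReal_mul h1p, ← ENNReal.ofReal_add (by positivity) (by positivity)]
    congr 1; ring

/-! ### The costs -/

open Classical in
/-- The exponential cost that a station at `x` with mark `z` causes to an active station at distance
`r`: its interference relative to the threshold, and `∞` if it is a closer active station outside
the disk of radius `D`. -/
noncomputable def cost (D α γ r : ℝ) (x : Plane) (z : Mark) : ℝ≥0∞ :=
  ENNReal.ofReal (γ * r ^ α * ‖x‖ ^ (-α) * z.2.2) +
    if z ∈ activeMarks ∧ (D < ‖x‖ ∧ ‖x‖ < r) then ⊤ else 0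

open Classical in
/-- The cost averaged over the mark, on the exponential scale. -/
noncomputable def meanCost (D α γ q r : ℝ) (x : Plane) : ℝ≥0∞ :=
  ENNReal.ofReal (Real.log (1 + γ * r ^ α * ‖x‖ ^ (-α))) +
    if D < ‖x‖ ∧ ‖x‖ < r then thinExponent q else 0

theorem measurable_cost (D α γ : ℝ) :
    Measurable fun z : ℝ × Plane × Mark => cost D α γ z.1 z.2.1 z.2.2 := by
  classical
  have h1 : Measurable fun z : ℝ × Plane × Mark =>
      ENNReal.ofReal (γ * z.1 ^ α * ‖z.2.1‖ ^ (-α) * z.2.2.2.2) := by fun_prop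
  refine h1.add (Measurable.ite ?_ measurable_const measurable_const)
  refine (measurable_snd.snd measurableSet_activeMarks).inter (MeasurableSet.inter ?_ ?_)
  · exact measurableSet_lt measurable_const measurable_snd.fst.norm
  · exact measurableSet_lt measurable_snd.fst.norm measurable_fst

theorem measurable_meanCost (D α γ q : ℝ) : Measurable (Function.uncurry (meanCost D α γ q)) := by
  classical
  have h1 : Measurable fun z : ℝ × Plane =>
      ENNReal.ofReal (Real.log (1 + γ * z.1 ^ α * ‖z.2‖ ^ (-α))) := by fun_prop
  refine h1.add (Measurable.ite (MeasurableSet.inter ?_ ?_) measurable_const measurable_const)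
  · exact measurableSet_lt measurable_const measurable_snd.norm
  · exact measurableSet_lt measurable_snd.norm measurable_fst

theorem lintegral_expNeg_cost_eq {p a D α γ r : ℝ} (hp0 : 0 ≤ p) (hp1 : p ≤ 1) (ha0 : 0 ≤ a)
    (ha1 : a ≤ 1) (hγ : 0 ≤ γ) (hr : 0 ≤ r) (x : Plane) :
    ∫⁻ z, expNeg (cost D α γ r x z) ∂markLaw p a = expNeg (meanCost D α γ (p * a) r x) := by
  classical
  exact lintegral_expNeg_cost hp0 hp1 ha0 ha1 (by positivity) _

/-- Both parts grow with `r`: the weight `r^α` of the interference and the region where active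
stations are forbidden. This is the monotonicity that `palm_eq_integral` demands. -/
theorem monotoneOn_meanCost {D α γ q : ℝ} (hα : 0 ≤ α) (hγ : 0 ≤ γ) :
    MonotoneOn (meanCost D α γ q) (Ici 0) := by
  intro r hr s hs hrs x
  have hr : 0 ≤ r := hr
  refine add_le_add (ENNReal.ofReal_le_ofReal (Real.log_le_log (by positivity) ?_)) ?_
  · gcongr
  · split_ifs with h1 h2
    · exact le_rfl
    · exact absurd ⟨h1.1, h1.2.trans_le hrs⟩ h2
    · exact zero_le
    · exact le_rfl

-- With `u = γ r^α / (‖x‖^α + γ r^α)`, the fading average is `1 - u`, and in the forbidden region `1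
-- - (1 - u)(1 - q) = u + q (1 - u)`. The origin is excluded, where `0 ^ (-α) = 0` by convention.
open Classical in
theorem one_sub_expNeg_meanCost {D α γ q r : ℝ} (hq0 : 0 ≤ q) (hq1 : q ≤ 1) (hγ : 0 ≤ γ)
    (hr : 0 ≤ r) {x : Plane} (hx : x ≠ 0) :
    1 - expNeg (meanCost D α γ q r x) =
      ENNReal.ofReal (γ * r ^ α / (‖x‖ ^ α + γ * r ^ α) +
        if D < ‖x‖ ∧ ‖x‖ < r then q * (1 - γ * r ^ α / (‖x‖ ^ α + γ * r ^ α)) else 0) := by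
  have hx0 : 0 < ‖x‖ := norm_pos_iff.2 hx
  have hxα : 0 < ‖x‖ ^ α := Real.rpow_pos_of_pos hx0 α
  have hc : 0 ≤ γ * r ^ α := by positivity
  set c := γ * r ^ α
  have h1 : (1 + c * ‖x‖ ^ (-α))⁻¹ = 1 - c / (‖x‖ ^ α + c) := by
    rw [Real.rpow_neg hx0.le]; field_simp; ring
  have h2 : 0 ≤ 1 - c / (‖x‖ ^ α + c) := by rw [← h1]; positivity
  rw [meanCost, expNeg_add, expNeg_log_one_add (by positivity), h1]
  split_ifs with h
  · rw [expNeg_thinExponent hq0 hq1, ← ENNReal.ofReal_mul h2, ← ENNReal.ofReal_one,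
      ← ENNReal.ofReal_sub _ (mul_nonneg h2 (by linarith))]
    congr 1; ring
  · rw [expNeg_zero, mul_one, ← ENNReal.ofReal_one, ← ENNReal.ofReal_sub _ h2]
    congr 1; ring

attribute [irreducible] cost meanCost

theorem integrableOn_radial_of_nonneg {α c : ℝ} (hα : 2 < α) (hc : 0 ≤ c) :
    IntegrableOn (fun ρ => ρ * (c / (ρ ^ α + c))) (Ioi 0) := by
  rcases eq_or_lt_of_le hc with h | h
  · simp [← h]
  · exact integrableOn_radial hα h

theorem integral_plane (f : ℝ → ℝ) :
    ∫ x : Plane, f ‖x‖ = 2 * Real.pi * ∫ ρ in Ioi (0 : ℝ), ρ * f ρ := by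
  rw [integral_fun_norm_addHaar, measureReal_def, EuclideanSpace.volume_ball_fin_two]
  simp [mul_assoc, Real.pi_pos.le]

theorem integrable_plane {f : ℝ → ℝ} (hf : IntegrableOn (fun ρ => ρ * f ρ) (Ioi 0)) :
    Integrable (fun x : Plane => f ‖x‖) := by
  rw [integrable_fun_norm_addHaar]
  simpa using hf

-- Polar coordinates reduce the exponent to radial integrals. The value `γ = 0` is admitted because
-- it yields the count of nearest stations.
open Classical in
theorem lintegral_one_sub_expNeg_meanCost {D α γ q r : ℝ} (hq0 : 0 ≤ q) (hq1 : q ≤ 1) (hγ : 0 ≤ γ)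
    (hα : 2 < α) (hD : 0 < D) (hr : D ≤ r) :
    ∃ Y, 0 ≤ Y ∧ ∫⁻ x, (1 - expNeg (meanCost D α γ q r x)) = ENNReal.ofReal Y ∧
      Y = 2 * Real.pi * ((∫ ρ in Ioi 0, ρ * (γ * r ^ α / (ρ ^ α + γ * r ^ α))) +
        q * ((r ^ 2 - D ^ 2) / 2 - ∫ ρ in Ioc D r, ρ * (γ * r ^ α / (ρ ^ α + γ * r ^ α)))) := by
  have hr0 : 0 < r := hD.trans_le hr
  have hc : 0 ≤ γ * r ^ α := by positivity
  set c := γ * r ^ α with hcdef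
  let f : ℝ → ℝ := fun ρ => c / (ρ ^ α + c) +
    if D < ρ ∧ ρ < r then q * (1 - c / (ρ ^ α + c)) else 0
  have hu := integrableOn_radial_of_nonneg hα hc
  have hsub : Ioo D r ⊆ Ioi 0 := fun x hx => hD.trans hx.1
  have huD := hu.mono_set hsub
  have hid : IntegrableOn (fun ρ : ℝ => ρ) (Ioo D r) :=
    (continuous_id.integrableOn_Icc).mono_set Ioo_subset_Icc_self
  have hv : IntegrableOn (fun ρ => q * (ρ - ρ * (c / (ρ ^ α + c)))) (Ioo D r) :=
    (hid.sub huD).const_mul q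
  have hsplit : ∀ ρ, ρ * f ρ = ρ * (c / (ρ ^ α + c)) +
      (Ioo D r).indicator (fun ρ => q * (ρ - ρ * (c / (ρ ^ α + c)))) ρ := by
    intro ρ
    simp only [f, indicator, mem_Ioo]
    split_ifs <;> ring
  have hvi : IntegrableOn ((Ioo D r).indicator (fun ρ => q * (ρ - ρ * (c / (ρ ^ α + c)))))
      (Ioi 0) := (hv.integrable_indicator measurableSet_Ioo).integrableOn
  have hfint : IntegrableOn (fun ρ => ρ * f ρ) (Ioi 0) := by
    simp_rw [hsplit]
    exact hu.add hvi
  have hae : ∀ᵐ x : Plane, 1 - expNeg (meanCost D α γ q r x) = ENNReal.ofReal (f ‖x‖) := by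
    filter_upwards [Measure.ae_ne volume (0 : Plane)] with x hx
    exact one_sub_expNeg_meanCost hq0 hq1 hγ hr0.le hx
  have hfnn : ∀ x : Plane, 0 ≤ f ‖x‖ := by
    intro x
    have h1 : c / (‖x‖ ^ α + c) ≤ 1 :=
      div_le_one_of_le₀ (le_add_of_nonneg_left (by positivity)) (by positivity)
    refine add_nonneg (by positivity) ?_
    split_ifs
    · exact mul_nonneg hq0 (sub_nonneg.2 h1)
    · exact le_rfl
  refine ⟨∫ x : Plane, f ‖x‖, integral_nonneg hfnn, ?_, ?_⟩
  · rw [lintegral_congr_ae hae, ← ofReal_integral_eq_lintegral_ofReal (integrable_plane hfint)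
      (ae_of_all _ hfnn)]
  rw [integral_plane]
  congr 1
  simp_rw [hsplit]
  rw [integral_add hu hvi, setIntegral_indicator measurableSet_Ioo,
    inter_eq_self_of_subset_right hsub, integral_const_mul, integral_sub hid huD,
    ← integral_Ioc_eq_integral_Ioo, ← integral_Ioc_eq_integral_Ioo,
    ← intervalIntegral.integral_of_le hr, integral_id]

/-! ### The exponents and the integrals of the theorem -/

theorem integral_radial_Ioc_Ioc {α γ r D : ℝ} (hα : 2 < α) (hγ : 0 < γ) (hD : 0 < D) (hr : D ≤ r) :
    ∫ ρ in Ioc D r, ρ * (γ * r ^ α / (ρ ^ α + γ * r ^ α)) =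
      (r ^ 2 * kappa1 α γ - r ^ 2 * kappa2 α γ -
        D ^ 2 * gaussHyp 1 (2 / α) (2 / α + 1) (-(D ^ α / (γ * r ^ α)))) / 2 := by
  have hr0 : 0 < r := hD.trans_le hr
  have hrα : 0 < r ^ α := Real.rpow_pos_of_pos hr0 α
  have hc : 0 < γ * r ^ α := by positivity
  have hu := integrableOn_radial hα hc
  have h1 := setIntegral_union (Ioc_disjoint_Ioi le_rfl) measurableSet_Ioi
    (hu.mono_set (fun x hx => hx.1 : Ioc 0 D ⊆ Ioi 0)) (hu.mono_set (Ioi_subset_Ioi hD.le))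
  have h2 := setIntegral_union (Ioc_disjoint_Ioi le_rfl) measurableSet_Ioi
    (hu.mono_set (fun x hx => hD.trans hx.1 : Ioc D r ⊆ Ioi 0))
    (hu.mono_set (Ioi_subset_Ioi hr0.le))
  rw [Ioc_union_Ioi_eq_Ioi hD.le, integral_radial hα hγ hr0, integral_radial_Ioc hα hγ hr0 hD] at h1
  rw [Ioc_union_Ioi_eq_Ioi hr, integral_radial_Ioi_eq hα hγ hr0] at h2
  linarith

theorem lam_eq (lam lamE p D : ℝ) : lam = lamC lam p + lamB lam lamE p D + lamA lam lamE p D := by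
  unfold lamC lamB lamA; ring

theorem lamA_eq (lam lamE p D : ℝ) : lamA lam lamE p D = lam * (p * activeProb lamE D) := by
  unfold lamA; ring

theorem integrand_eq (lam lamE p D α γ θ r : ℝ) : integrand lam lamE p D α γ θ r =
    2 * Real.pi * lamA lam lamE p D * r *
      Real.exp (-(Real.pi * ((lamC lam p + lamB lam lamE p D) * kappa1 α γ
        + lamA lam lamE p D * kappa2 α γ) * r ^ 2 - θ
        + Real.pi * lamA lam lamE p D * (r ^ 2 - D ^ 2))) := by
  rw [integrand, distPDF, mul_left_comm, ← Real.exp_add]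
  congr 2; ring

/-- All stations interfere over the whole plane, giving `lam κ₁`. For active ones the range `(D, r]`
is replaced by a full exclusion: what is left of their `κ₁` is `κ₂` and the disk term `-Θ`, and the
exclusion is the exponent of the distance density. -/
theorem exponent_eq {lam lamE p D α γ r : ℝ} (hα : 2 < α) (hγ : 0 < γ) (hD : 0 < D) (hr : D ≤ r) :
    lam * (2 * Real.pi * ((∫ ρ in Ioi 0, ρ * (γ * r ^ α / (ρ ^ α + γ * r ^ α))) +
      (p * activeProb lamE D) * ((r ^ 2 - D ^ 2) / 2 -
        ∫ ρ in Ioc D r, ρ * (γ * r ^ α / (ρ ^ α + γ * r ^ α))))) =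
      Real.pi * ((lamC lam p + lamB lam lamE p D) * kappa1 α γ
        + lamA lam lamE p D * kappa2 α γ) * r ^ 2 - Theta lam lamE p D α γ r
        + Real.pi * lamA lam lamE p D * (r ^ 2 - D ^ 2) := by
  rw [integral_radial hα hγ (hD.trans_le hr), integral_radial_Ioc_Ioc hα hγ hD hr, Theta]
  unfold lamC lamB lamA
  ring

theorem continuousOn_Theta {lam lamE p D α γ : ℝ} (hα : 2 < α) (hγ : 0 < γ) (hD : 0 < D) :
    ContinuousOn (Theta lam lamE p D α γ) (Ici D) := by
  have hα0 : 0 < α := by linarith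
  have hg := (analyticOnNhd_gaussHyp (a := 1) (b := 2 / α) (c := 2 / α + 1) (by positivity)
    (by linarith)).continuousOn
  have hpos : ∀ r ∈ Ici D, 0 < γ * r ^ α := fun r hr =>
    mul_pos hγ (Real.rpow_pos_of_pos (hD.trans_le hr) α)
  refine continuousOn_const.mul (hg.comp ?_ ?_)
  · refine (continuousOn_const.div (continuousOn_const.mul
      (continuousOn_id.rpow_const fun r hr => Or.inl (hD.trans_le hr).ne')) fun r hr =>
      (hpos r hr).ne').neg
  · intro r hr
    have := div_pos (Real.rpow_pos_of_pos hD α) (hpos r hr)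
    exact (neg_neg_of_pos this).trans one_pos

theorem Theta_lt {lam lamE p D α γ r : ℝ} (hα : 2 < α) (hγ : 0 < γ) (hD : 0 < D)
    (hA : 0 < lamA lam lamE p D) (hr : D < r) :
    Theta lam lamE p D α γ r < Theta lam lamE p D α γ D := by
  have hα0 : 0 < α := by linarith
  have hDα : 0 < D ^ α := Real.rpow_pos_of_pos hD α
  have hlt : D ^ α < r ^ α := Real.rpow_lt_rpow hD.le hr hα0
  have h := gaussHyp_one_lt (b := 2 / α) (x := -(D ^ α / (γ * D ^ α)))
    (y := -(D ^ α / (γ * r ^ α))) (by positivity) ?_ ?_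
  · unfold Theta
    have hc : 0 < Real.pi * lamA lam lamE p D * D ^ 2 := by positivity
    nlinarith
  · rw [neg_lt_neg_iff]
    gcongr
  · have hrα := hDα.trans hlt
    have : 0 < D ^ α / (γ * r ^ α) := by positivity
    linarith

theorem kappa1_pos {α γ : ℝ} (hα : 2 < α) (hγ : 0 < γ) : 0 < kappa1 α γ := by
  have hα0 : 0 < α := by linarith
  have h1 : 2 / α < 1 := (div_lt_one hα0).2 hα
  have := beta_pos (sub_pos.2 h1) (by positivity : 0 < 2 / α)
  unfold kappa1
  positivity

theorem kappa2_nonneg {α γ : ℝ} (hα : 2 < α) (hγ : 0 < γ) : 0 ≤ kappa2 α γ := by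
  have h := integral_radial_Ioi_eq hα hγ one_pos
  have h0 : 0 ≤ ∫ ρ in Ioi (1 : ℝ), ρ * (γ * 1 ^ α / (ρ ^ α + γ * 1 ^ α)) := by
    refine setIntegral_nonneg measurableSet_Ioi fun ρ hρ => ?_
    have : (0 : ℝ) < ρ := one_pos.trans hρ
    positivity
  rw [h] at h0
  linarith

theorem hasDerivAt_exp_neg_mul_sq (b r : ℝ) :
    HasDerivAt (fun r : ℝ => Real.exp (-b * r ^ 2)) (-(2 * b) * (r * Real.exp (-b * r ^ 2))) r := by
  have h := (((hasDerivAt_id r).pow 2).const_mul (-b)).exp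
  simp only [id] at h
  refine h.congr_deriv ?_
  simp
  ring

theorem integral_mul_exp_neg_mul_sq_Ioi {b : ℝ} (hb : 0 < b) (D : ℝ) :
    ∫ r in Ioi D, r * Real.exp (-b * r ^ 2) = Real.exp (-b * D ^ 2) / (2 * b) := by
  have hint : IntegrableOn (fun r : ℝ => -(2 * b) * (r * Real.exp (-b * r ^ 2))) (Ioi D) :=
    ((integrable_mul_exp_neg_mul_sq hb).const_mul _).integrableOn
  have hlim : Tendsto (fun r : ℝ => Real.exp (-b * r ^ 2)) atTop (𝓝 0) := by
    refine Real.tendsto_exp_atBot.comp ?_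
    exact (tendsto_pow_atTop two_ne_zero).const_mul_atTop_of_neg (neg_neg_of_pos hb)
  have h := integral_Ioi_of_hasDerivAt_of_tendsto'
    (fun r _ => hasDerivAt_exp_neg_mul_sq b r) hint hlim
  rw [integral_const_mul] at h
  rw [eq_div_iff (by positivity)]
  linarith

theorem integral_distPDF (lam lamE p D t : ℝ) :
    ∫ r in D..t, distPDF lam lamE p D r =
      1 - Real.exp (-(Real.pi * lamA lam lamE p D * (t ^ 2 - D ^ 2))) := by
  set k := Real.pi * lamA lam lamE p D with hk
  have hd : ∀ r ∈ uIcc D t, HasDerivAt (fun r : ℝ => -Real.exp (-(k * (r ^ 2 - D ^ 2))))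
      (distPDF lam lamE p D r) r := by
    intro r _
    have h := (((((hasDerivAt_id r).pow 2).sub_const (D ^ 2)).const_mul k).neg.exp).neg
    simp only [id] at h
    refine h.congr_deriv ?_
    rw [distPDF, show -Real.pi * lamA lam lamE p D * (r ^ 2 - D ^ 2) = -(k * (r ^ 2 - D ^ 2)) by
      rw [hk]; ring]
    simp [hk]
    ring
  rw [intervalIntegral.integral_eq_sub_of_hasDerivAt hd
    (Continuous.intervalIntegrable (by unfold distPDF; fun_prop) _ _)]
  simp
  ring

section Bounds

variable {lam lamE p D α γ : ℝ}

theorem lamA_pos (hlam : 0 < lam) (hp0 : 0 < p) : 0 < lamA lam lamE p D := by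
  unfold lamA activeProb; positivity

theorem activeProb_le_one (hlamE : 0 ≤ lamE) : activeProb lamE D ≤ 1 := by
  rw [activeProb, Real.exp_le_one_iff]
  have : 0 ≤ lamE * Real.pi * D ^ 2 := by positivity
  linarith

/-- For `θ` independent of `r`, this exhibits an elementary primitive and integrability at once. -/
theorem integrand_const_eq (θ r : ℝ) : integrand lam lamE p D α γ θ r =
    2 * Real.pi * lamA lam lamE p D * Real.exp (θ + Real.pi * lamA lam lamE p D * D ^ 2) *
      (r * Real.exp (-(Real.pi * ((lamC lam p + lamB lam lamE p D) * kappa1 α γ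
        + lamA lam lamE p D * kappa2 α γ + lamA lam lamE p D)) * r ^ 2)) := by
  rw [integrand_eq]
  have : ∀ a b c : ℝ, a * Real.exp b * (r * Real.exp c) = a * r * Real.exp (b + c) := by
    intro a b c; rw [Real.exp_add]; ring
  rw [this]
  congr 2; ring

theorem rate_pos (hlam : 0 < lam) (hlamE : 0 ≤ lamE) (hp0 : 0 < p) (hp1 : p ≤ 1) (hα : 2 < α)
    (hγ : 0 < γ) : 0 < Real.pi * ((lamC lam p + lamB lam lamE p D) * kappa1 α γ
        + lamA lam lamE p D * kappa2 α γ + lamA lam lamE p D) := by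
  have h1 := lamA_pos (lamE := lamE) (D := D) hlam hp0
  have h2 := kappa1_pos hα hγ
  have h3 := kappa2_nonneg hα hγ
  have h4 : 0 ≤ lamC lam p := mul_nonneg (by linarith) hlam.le
  have h5 : 0 ≤ lamB lam lamE p D :=
    mul_nonneg (by positivity) (sub_nonneg.2 (activeProb_le_one hlamE))
  positivity

theorem integrableOn_integrand_const (hlam : 0 < lam) (hlamE : 0 ≤ lamE) (hp0 : 0 < p)
    (hp1 : p ≤ 1) (hα : 2 < α) (hγ : 0 < γ) (θ : ℝ) :
    IntegrableOn (fun r => integrand lam lamE p D α γ θ r) (Ioi D) := by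
  simp_rw [integrand_const_eq]
  exact ((integrable_mul_exp_neg_mul_sq
    (rate_pos hlam hlamE hp0 hp1 hα hγ)).const_mul _).integrableOn

theorem integral_integrand_Theta_self (hlam : 0 < lam) (hlamE : 0 ≤ lamE) (hp0 : 0 < p)
    (hp1 : p ≤ 1) (hα : 2 < α) (hγ : 0 < γ) (hD : 0 < D) :
    1 - ∫ r in Ioi D, integrand lam lamE p D α γ (Theta lam lamE p D α γ D) r =
      lowerBound lam lamE p D α γ := by
  have hA := lamA_pos (lamE := lamE) (D := D) hlam hp0
  have hrate := rate_pos (D := D) hlam hlamE hp0 hp1 hα hγ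
  have hDα : 0 < D ^ α := Real.rpow_pos_of_pos hD α
  simp_rw [integrand_const_eq]
  rw [integral_const_mul, integral_mul_exp_neg_mul_sq_Ioi hrate, lowerBound]
  -- The factor `exp (π λₑ D²)` in `τ₂` cancels the activity probability, so `λₐᵢ τ₂ / p = lam κ₁`;
  -- then `lam` is split into its three densities.
  have hden : lamA lam lamE p D * (tau1 α γ + tau2 lamE D α γ / p) =
      (lamC lam p + lamB lam lamE p D) * kappa1 α γ
        + lamA lam lamE p D * kappa2 α γ + lamA lam lamE p D := by
    have he : activeProb lamE D * Real.exp (Real.pi * lamE * D ^ 2) = 1 := by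
      rw [activeProb, ← Real.exp_add, ← Real.exp_zero]
      congr 1; ring
    have h2 : lamA lam lamE p D * (tau2 lamE D α γ / p) = lam * kappa1 α γ := by
      have : lamA lam lamE p D * (tau2 lamE D α γ / p) =
          lam * kappa1 α γ * (activeProb lamE D * Real.exp (Real.pi * lamE * D ^ 2)) := by
        unfold lamA tau2; field_simp
      rw [this, he, mul_one]
    rw [mul_add, h2, tau1]
    nth_rewrite 2 [lam_eq lam lamE p D]
    ring
  rw [← hden] at hrate ⊢
  have hτ : tau1 α γ + tau2 lamE D α γ / p ≠ 0 := by
    intro h; rw [h] at hrate; simp at hrate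
  have hexp : Real.exp (Theta lam lamE p D α γ D + Real.pi * lamA lam lamE p D * D ^ 2) *
      Real.exp (-(Real.pi * (lamA lam lamE p D * (tau1 α γ + tau2 lamE D α γ / p))) * D ^ 2) =
      Real.exp (-Real.pi * D ^ 2 * kappa1 α γ * lam) := by
    rw [← Real.exp_add, hden, Theta]
    have hz : D ^ α / (γ * D ^ α) = 1 / γ := by field_simp
    have hk := kappa1_eq hα hγ
    congr 1
    rw [hz]
    -- At `r = D` the argument of `Θ` is `-1/γ`, so `kappa1_eq` merges `Θ(D)` with the `κ₂` term
    -- into `κ₁`.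
    linear_combination (Real.pi * D ^ 2 * lamA lam lamE p D) * hk +
      (Real.pi * D ^ 2 * kappa1 α γ) * lam_eq lam lamE p D
  rw [← hexp]
  have hpi := Real.pi_ne_zero
  field_simp

/-- The integrand is dominated by its version with the constant `Θ(D)`, since `Θ(r) < Θ(D)` beyond
`D`. -/
theorem integrableOn_integrand_Theta (hlam : 0 < lam) (hlamE : 0 ≤ lamE) (hp0 : 0 < p)
    (hp1 : p ≤ 1) (hα : 2 < α) (hγ : 0 < γ) (hD : 0 < D) :
    IntegrableOn (fun r => integrand lam lamE p D α γ (Theta lam lamE p D α γ r) r) (Ioi D) := by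
  have hA := lamA_pos (lamE := lamE) (D := D) hlam hp0
  refine Integrable.mono' (integrableOn_integrand_const hlam hlamE hp0 hp1 hα hγ
    (Theta lam lamE p D α γ D)) ?_ ?_
  · refine ContinuousOn.aestronglyMeasurable ?_ measurableSet_Ioi
    have hΘ := (continuousOn_Theta (lam := lam) (lamE := lamE) (p := p) hα hγ hD).mono
      Ioi_subset_Ici_self
    unfold integrand distPDF
    fun_prop
  · filter_upwards [ae_restrict_mem measurableSet_Ioi] with r hr
    have hr0 : 0 < r := hD.trans hr
    have hΘ := Theta_lt hα hγ hD hA hr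
    rw [integrand, integrand, distPDF, Real.norm_of_nonneg (by positivity)]
    gcongr

theorem integral_integrand_Theta_lt (hlam : 0 < lam) (hlamE : 0 ≤ lamE) (hp0 : 0 < p)
    (hp1 : p ≤ 1) (hα : 2 < α) (hγ : 0 < γ) (hD : 0 < D) :
    ∫ r in Ioi D, integrand lam lamE p D α γ (Theta lam lamE p D α γ r) r <
      ∫ r in Ioi D, integrand lam lamE p D α γ (Theta lam lamE p D α γ D) r := by
  have hA := lamA_pos (lamE := lamE) (D := D) hlam hp0
  refine setIntegral_lt_setIntegral measurableSet_Ioi (by simp)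
    (integrableOn_integrand_Theta hlam hlamE hp0 hp1 hα hγ hD)
    (integrableOn_integrand_const hlam hlamE hp0 hp1 hα hγ _) fun r hr => ?_
  have hr0 : 0 < r := hD.trans hr
  have hΘ := Theta_lt hα hγ hD hA hr
  rw [integrand, integrand, distPDF]
  gcongr

end Bounds

/-! ### Capture events and the nearest active station. -/

/-- A Poisson process with independent marks, as in `Network`, but with measurable marks. -/
structure IsMarkedPoisson {Ω : Type*} [MeasurableSpace Ω] (μ : Measure Ω) (lam p a : ℝ)
    (X : ℕ → Ω → Plane) (m : ℕ → Ω → Mark) : Prop where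
  isPoisson : IsPoissonProcess μ lam X
  measurable_mark : ∀ n, Measurable (m n)
  map_mark : ∀ n, μ.map (m n) = markLaw p a
  indep_mark : iIndepFun m μ
  indep_loc_mark : IndepFun (fun ω n => X n ω) (fun ω n => m n ω) μ

section Capture

variable {Ω : Type*} {X : ℕ → Ω → Plane} {m : ℕ → Ω → Mark} {D α γ t : ℝ} {e : ℕ} {ω : Ω}

/-- Station `e` is an active station with `D < ‖Xₑ‖ ≤ t`, and its fading exceeds the total cost of
the other stations. -/
def capture (X : ℕ → Ω → Plane) (m : ℕ → Ω → Mark) (D α γ t : ℝ) (e : ℕ) : Set Ω :=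
  {ω | X e ω ∈ annulus D t ∧ m e ω ∈ activeMarks ∧
    ∑' n, (if n = e then 0 else cost D α γ ‖X e ω‖ (X n ω) (m n ω)) ≤ ENNReal.ofReal (m e ω).2.2}

/-- Station `e` is a nearest active station outside the disk of radius `D`. -/
def IsNearest (X : ℕ → Ω → Plane) (m : ℕ → Ω → Mark) (D : ℝ) (ω : Ω) (e : ℕ) : Prop :=
  m e ω ∈ activeMarks ∧ D < ‖X e ω‖ ∧
    ∀ n, m n ω ∈ activeMarks → D < ‖X n ω‖ → ‖X e ω‖ ≤ ‖X n ω‖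

/-- There is an active station in the annulus `D < ‖x‖ ≤ t`. -/
def activeIn (X : ℕ → Ω → Plane) (m : ℕ → Ω → Mark) (D t : ℝ) : Set Ω :=
  {ω | ∃ n, m n ω ∈ activeMarks ∧ X n ω ∈ annulus D t}

theorem IsNearest.tsum_cost (h : IsNearest X m D ω e) :
    ∑' n, (if n = e then 0 else cost D α γ ‖X e ω‖ (X n ω) (m n ω)) =
      ∑' n, if n = e then 0 else
        ENNReal.ofReal (γ * ‖X e ω‖ ^ α * ‖X n ω‖ ^ (-α) * (m n ω).2.2) := by
  refine tsum_congr fun n => ?_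
  have : ¬ (m n ω ∈ activeMarks ∧ D < ‖X n ω‖ ∧ ‖X n ω‖ < ‖X e ω‖) := fun hn =>
    not_lt.2 (h.2.2 n hn.1 hn.2.1) hn.2.2
  rw [cost, if_neg this, add_zero]

/-- A closer active station outside the disk would make the total cost infinite, whereas the fading
gain is finite. -/
theorem isNearest_of_mem_capture (h : ω ∈ capture X m D α γ t e) : IsNearest X m D ω e := by
  refine ⟨h.2.1, h.1.1, fun n hn hD => ?_⟩
  by_contra hlt
  have hlt := not_le.1 hlt
  have hne : n ≠ e := by rintro rfl; exact lt_irrefl _ hlt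
  have h1 := (ENNReal.le_tsum n).trans h.2.2
  rw [if_neg hne, cost, if_pos ⟨hn, hD, hlt⟩, add_top, top_le_iff] at h1
  exact ENNReal.ofReal_ne_top h1

theorem mem_capture_iff : ω ∈ capture X m D α γ t e ↔ IsNearest X m D ω e ∧ ‖X e ω‖ ≤ t ∧
    (∑' n, if n = e then 0 else
      ENNReal.ofReal (γ * ‖X e ω‖ ^ α * ‖X n ω‖ ^ (-α) * (m n ω).2.2)) ≤
        ENNReal.ofReal (m e ω).2.2 := by
  constructor
  · intro h
    have hn := isNearest_of_mem_capture h
    exact ⟨hn, h.1.2, hn.tsum_cost ▸ h.2.2⟩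
  · rintro ⟨hn, ht, h⟩
    exact ⟨⟨hn.2.1, ht⟩, hn.1, hn.tsum_cost ▸ h⟩

theorem mem_capture_zero_iff :
    ω ∈ capture X m D α 0 t e ↔ IsNearest X m D ω e ∧ ‖X e ω‖ ≤ t := by
  rw [mem_capture_iff]; simp

/-- Finitely many stations lie in the annulus, so the minimum distance is attained there; stations
beyond `t` are farther away anyway. -/
theorem exists_isNearest (hfin : pointCount X (annulus D t) ω ≠ ⊤) (h : ω ∈ activeIn X m D t) :
    ∃ e, IsNearest X m D ω e ∧ ‖X e ω‖ ≤ t := by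
  have hf : {n | m n ω ∈ activeMarks ∧ X n ω ∈ annulus D t}.Finite :=
    (encard_ne_top_iff.1 hfin).subset fun n hn => hn.2
  obtain ⟨e, he, hmin⟩ := exists_min_image _ (fun n => ‖X n ω‖) hf h
  refine ⟨e, ⟨he.1, he.2.1, fun n hn hD => ?_⟩, he.2.2⟩
  rcases le_or_gt ‖X n ω‖ t with hnt | hnt
  · exact hmin n ⟨hn, hD, hnt⟩
  · exact he.2.2.trans hnt.le

end Capture

namespace IsMarkedPoisson

variable {Ω : Type*} [MeasurableSpace Ω] {μ : Measure Ω}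
  {lam lamE p a D α γ t : ℝ} {X : ℕ → Ω → Plane} {m : ℕ → Ω → Mark}

theorem measurableSet_capture (h : IsMarkedPoisson μ lam p a X m) (e : ℕ) :
    MeasurableSet (capture X m D α γ t e) := by
  refine (h.isPoisson.measurable_point e (measurableSet_annulus D t)).inter
    ((h.measurable_mark e measurableSet_activeMarks).inter (measurableSet_le
      (Measurable.tsum fun n => ?_) (h.measurable_mark e).snd.snd.ennreal_ofReal))
  by_cases hn : n = e
  · simp [hn]
  · simp only [hn, if_false]
    have hg : Measurable fun ω => (‖X e ω‖, X n ω, m n ω) :=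
      (h.isPoisson.measurable_point e).norm.prodMk
        ((h.isPoisson.measurable_point n).prodMk (h.measurable_mark n))
    exact Measurable.comp (g := fun z : ℝ × Plane × Mark => cost D α γ z.1 z.2.1 z.2.2)
      (measurable_cost D α γ) hg

theorem measurableSet_activeIn (h : IsMarkedPoisson μ lam p a X m) :
    MeasurableSet (activeIn X m D t) := by
  have : activeIn X m D t = ⋃ n, {ω | m n ω ∈ activeMarks ∧ X n ω ∈ annulus D t} := by
    ext ω; simp [activeIn]
  rw [this]
  exact MeasurableSet.iUnion fun n => (h.measurable_mark n measurableSet_activeMarks).inter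
    (h.isPoisson.measurable_point n (measurableSet_annulus D t))

theorem ae_pointCount_ne_top (h : IsMarkedPoisson μ lam p a X m) (hlam : 0 ≤ lam) (hD : 0 ≤ D)
    (ht : D ≤ t) : ∀ᵐ ω ∂μ, pointCount X (annulus D t) ω ≠ ⊤ := by
  have hA := measurableSet_annulus D t
  have hAv : volume (annulus D t) ≠ ⊤ := by rw [volume_annulus hD ht]; simp
  have h1 := h.isPoisson.lintegral_pointCount hlam hA hAv
  filter_upwards [ae_lt_top (measurable_toENNReal.comp (h.isPoisson.measurable_pointCount hA))
    (by simp only [Function.comp_def]; rw [h1]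
        exact ENNReal.mul_ne_top ENNReal.ofReal_ne_top hAv)] with ω hω htop
  simp [htop] at hω

variable [IsProbabilityMeasure μ]

/-- The mark of station `e` contributes the activity probability `p a` and the exponential tail; the
marks of the others turn `cost` into `meanCost`. -/
theorem tsum_measure_capture (h : IsMarkedPoisson μ lam p a X m) (hp0 : 0 ≤ p) (hp1 : p ≤ 1)
    (ha0 : 0 ≤ a) (ha1 : a ≤ 1) (hγ : 0 ≤ γ) :
    ∑' e, μ (capture X m D α γ t e) =
      ENNReal.ofReal (p * a) * palm μ X (meanCost D α γ (p * a)) D t := by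
  have hmc := measurable_meanCost D α γ (p * a)
  rw [palm_eq_tsum h.isPoisson.measurable_point hmc, ← ENNReal.tsum_mul_left]
  have hF : Measurable fun z : Plane × Plane × Mark => cost D α γ ‖z.1‖ z.2.1 z.2.2 :=
    Measurable.comp (g := fun z : ℝ × Plane × Mark => cost D α γ z.1 z.2.1 z.2.2)
      (measurable_cost D α γ) (measurable_fst.norm.prodMk measurable_snd)
  have hFb : Measurable (Function.uncurry fun y x : Plane => meanCost D α γ (p * a) ‖y‖ x) :=
    Measurable.comp (g := Function.uncurry (meanCost D α γ (p * a)))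
      (f := fun z : Plane × Plane => (‖z.1‖, z.2)) hmc
      (measurable_fst.norm.prodMk measurable_snd)
  refine tsum_congr fun e => ?_
  exact measure_marked_tsum_le (F := fun y x z => cost D α γ ‖y‖ x z)
    (Fb := fun y x => meanCost D α γ (p * a) ‖y‖ x) (H := fun z => ENNReal.ofReal z.2.2)
    h.isPoisson.measurable_point h.measurable_mark
    h.map_mark h.indep_mark h.indep_loc_mark
    hF hFb (fun y x => lintegral_expNeg_cost_eq hp0 hp1 ha0 ha1 hγ (norm_nonneg y) x)
    (measurableSet_annulus D t) measurableSet_activeMarks measurable_snd.snd.ennreal_ofReal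
    (markLaw_active_tail p a hp0) e

/-- The expected number of captures in terms of the exponent of the interference functional. -/
theorem toReal_tsum_capture (h : IsMarkedPoisson μ lam p a X m) (hlam : 0 ≤ lam) (hp0 : 0 ≤ p)
    (hp1 : p ≤ 1) (ha0 : 0 ≤ a) (ha1 : a ≤ 1) (hγ : 0 ≤ γ) (hα : 2 < α) (hD : 0 < D)
    {E : ℝ → ℝ} (hE : ContinuousOn E (Ici D))
    (hEeq : ∀ r, D ≤ r → lam * (2 * Real.pi *
      ((∫ ρ in Ioi 0, ρ * (γ * r ^ α / (ρ ^ α + γ * r ^ α))) + (p * a) * ((r ^ 2 - D ^ 2) / 2 -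
        ∫ ρ in Ioc D r, ρ * (γ * r ^ α / (ρ ^ α + γ * r ^ α))))) = E r)
    (ht : D ≤ t) :
    (∑' e, μ (capture X m D α γ t e)).toReal =
      ∫ r in D..t, 2 * Real.pi * (lam * (p * a)) * r * Real.exp (-E r) := by
  have hpa0 : 0 ≤ p * a := mul_nonneg hp0 ha0
  have hK : ∀ r, D ≤ r → Real.exp (-E r) = (expNeg (ENNReal.ofReal lam *
      ∫⁻ x, (1 - expNeg (meanCost D α γ (p * a) r x)))).toReal := by
    intro r hr
    obtain ⟨Y, hY0, hY, hYeq⟩ := lintegral_one_sub_expNeg_meanCost hpa0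
      (mul_le_one₀ hp1 ha0 ha1) hγ hα hD hr
    rw [hY, ← ENNReal.ofReal_mul hlam, expNeg_ofReal (by positivity),
      ENNReal.toReal_ofReal (Real.exp_pos _).le, ← hEeq r hr, hYeq]
  rw [h.tsum_measure_capture hp0 hp1 ha0 ha1 hγ, ENNReal.toReal_mul, ENNReal.toReal_ofReal hpa0,
    palm_eq_integral h.isPoisson hlam (measurable_meanCost D α γ (p * a))
      (monotoneOn_meanCost (by linarith) hγ) hD.le (K := fun r => Real.exp (-E r))
      (Real.continuous_exp.comp_continuousOn hE.neg) hK ht, ← intervalIntegral.integral_const_mul]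
  refine intervalIntegral.integral_congr fun r _ => ?_
  ring

theorem toReal_tsum_capture_eq (h : IsMarkedPoisson μ lam p (activeProb lamE D) X m)
    (hlam : 0 < lam) (hlamE : 0 ≤ lamE) (hp0 : 0 < p) (hp1 : p ≤ 1) (hα : 2 < α) (hγ : 0 < γ)
    (hD : 0 < D) (ht : D ≤ t) :
    (∑' e, μ (capture X m D α γ t e)).toReal =
      ∫ r in D..t, integrand lam lamE p D α γ (Theta lam lamE p D α γ r) r := by
  rw [h.toReal_tsum_capture hlam.le hp0.le hp1 (Real.exp_pos _).le (activeProb_le_one hlamE) hγ.le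
    hα hD (E := fun r => Real.pi * ((lamC lam p + lamB lam lamE p D) * kappa1 α γ
        + lamA lam lamE p D * kappa2 α γ) * r ^ 2 - Theta lam lamE p D α γ r
        + Real.pi * lamA lam lamE p D * (r ^ 2 - D ^ 2)) ?_
    (fun r hr => exponent_eq hα hγ hD hr) ht]
  · refine intervalIntegral.integral_congr fun r _ => ?_
    rw [integrand_eq, lamA_eq]
  · have := continuousOn_Theta (lam := lam) (lamE := lamE) (p := p) hα hγ hD
    fun_prop

theorem tsum_capture_zero (h : IsMarkedPoisson μ lam p (activeProb lamE D) X m)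
    (hlam : 0 < lam) (hlamE : 0 ≤ lamE) (hp0 : 0 < p) (hp1 : p ≤ 1) (hα : 2 < α)
    (hD : 0 < D) (ht : D ≤ t) :
    ∑' e, μ (capture X m D α 0 t e) =
      ENNReal.ofReal (1 - Real.exp (-(Real.pi * lamA lam lamE p D * (t ^ 2 - D ^ 2)))) := by
  have h1 := h.toReal_tsum_capture hlam.le hp0.le hp1 (Real.exp_pos _).le
    (activeProb_le_one hlamE) le_rfl hα hD (t := t)
    (E := fun r => Real.pi * lamA lam lamE p D * (r ^ 2 - D ^ 2)) (by fun_prop)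
    (fun r hr => by rw [lamA_eq]; simp; ring) ht
  have hfin : ∑' e, μ (capture X m D α 0 t e) ≠ ⊤ := by
    rw [h.tsum_measure_capture hp0.le hp1 (Real.exp_pos _).le (activeProb_le_one hlamE) le_rfl]
    exact ENNReal.mul_ne_top ENNReal.ofReal_ne_top (ne_top_of_le_ne_top ENNReal.ofReal_ne_top
      (palm_le h.isPoisson hlam.le hD.le ht))
  rw [← ENNReal.ofReal_toReal hfin, h1, ← integral_distPDF]
  congr 1
  refine intervalIntegral.integral_congr fun r _ => ?_
  rw [distPDF, lamA_eq]
  ring_nf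

/-- This is the void probability of the thinned process. It is computed without reference to nearest
stations, so that it can be compared with `tsum_capture_zero`. -/
theorem measure_activeIn (h : IsMarkedPoisson μ lam p (activeProb lamE D) X m)
    (hlam : 0 < lam) (hlamE : 0 ≤ lamE) (hp0 : 0 < p) (hp1 : p ≤ 1) (hD : 0 < D) (ht : D ≤ t) :
    μ (activeIn X m D t) =
      ENNReal.ofReal (1 - Real.exp (-(Real.pi * lamA lam lamE p D * (t ^ 2 - D ^ 2)))) := by
  classical
  set a := activeProb lamE D with ha
  have ha0 : 0 ≤ a := (Real.exp_pos _).le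
  have ha1 : a ≤ 1 := activeProb_le_one hlamE
  have hpa0 : 0 ≤ p * a := by positivity
  have hpa1 : p * a ≤ 1 := mul_le_one₀ hp1 ha0 ha1
  have hA := measurableSet_annulus D t
  have hAv := volume_annulus hD.le ht
  have hts : 0 ≤ t ^ 2 - D ^ 2 := by nlinarith
  -- With zero fading weight and infinite cost for active stations in the annulus, the
  -- multiplicative functional is the indicator that there are none.
  have h1 := lintegral_expNeg_tsum_marked h.isPoisson.measurable_point h.measurable_mark h.map_mark
    h.indep_mark h.indep_loc_mark
    (F := fun x z => ENNReal.ofReal (0 * z.2.2) +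
      if z ∈ activeMarks ∧ x ∈ annulus D t then ⊤ else 0)
    (Fb := fun x => ENNReal.ofReal (Real.log (1 + 0)) +
      if x ∈ annulus D t then thinExponent (p * a) else 0)
    (by
      have h2 : Measurable fun z : Plane × Mark =>
          if z.2 ∈ activeMarks ∧ z.1 ∈ annulus D t then (⊤ : ℝ≥0∞) else 0 :=
        Measurable.ite ((measurable_snd measurableSet_activeMarks).inter (measurable_fst hA))
          measurable_const measurable_const
      have h3 : Measurable fun z : Plane × Mark => ENNReal.ofReal (0 * z.2.2.2) := by fun_prop
      exact h3.add h2)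
    (fun x => lintegral_expNeg_cost hp0.le hp1 ha0 ha1 le_rfl _)
  have h2 : ∀ ω, expNeg (∑' n, (ENNReal.ofReal (0 * (m n ω).2.2) +
      if m n ω ∈ activeMarks ∧ X n ω ∈ annulus D t then ⊤ else 0)) =
      (activeIn X m D t)ᶜ.indicator 1 ω := by
    intro ω
    by_cases hω : ω ∈ activeIn X m D t
    · obtain ⟨n, hn⟩ := hω
      have htop : ∑' n, (ENNReal.ofReal (0 * (m n ω).2.2) +
          if m n ω ∈ activeMarks ∧ X n ω ∈ annulus D t then ⊤ else 0) = ⊤ := by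
        rw [← top_le_iff]
        refine le_trans ?_ (ENNReal.le_tsum n)
        simp [hn]
      rw [htop, expNeg_top, indicator_of_notMem (not_not.2 ⟨n, hn⟩)]
    · have hz : ∀ n, (ENNReal.ofReal (0 * (m n ω).2.2) +
          if m n ω ∈ activeMarks ∧ X n ω ∈ annulus D t then (⊤ : ℝ≥0∞) else 0) = 0 := by
        intro n
        rw [if_neg fun hn => hω ⟨n, hn⟩]
        simp
      simp_rw [hz]
      rw [tsum_zero, expNeg_zero, indicator_of_mem hω, Pi.one_apply]
  have h3 : ∀ ω, ∑' n, (ENNReal.ofReal (Real.log (1 + 0)) +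
      if X n ω ∈ annulus D t then thinExponent (p * a) else 0) =
      thinExponent (p * a) * (pointCount X (annulus D t) ω : ℕ∞) := by
    intro ω
    rw [pointCount_eq_tsum, ← ENNReal.tsum_mul_left]
    refine tsum_congr fun n => ?_
    simp [indicator]
  simp_rw [h2, h3] at h1
  rw [lintegral_indicator_one h.measurableSet_activeIn.compl,
    h.isPoisson.lintegral_expNeg_count hlam.le hA (by rw [hAv]; simp),
    expNeg_thinExponent hpa0 hpa1, hAv, ← ENNReal.ofReal_one,
    ← ENNReal.ofReal_sub _ (by linarith), ← ENNReal.ofReal_mul hlam.le,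
    ← ENNReal.ofReal_mul (by positivity), sub_sub_cancel, expNeg_ofReal (by positivity)] at h1
  have h4 := prob_compl_eq_one_sub (μ := μ)
    (h.measurableSet_activeIn (D := D) (t := t)).compl
  rw [compl_compl, h1, ← ENNReal.ofReal_one, ← ENNReal.ofReal_sub _ (Real.exp_pos _).le] at h4
  rw [h4, lamA_eq, ha]
  congr 4
  ring

/-- If an active station lies in the annulus, at least one is nearest, so the left side is at most
the right side almost surely. Both have the same finite expectation, hence they agree. Ties are
thereby excluded without studying the joint law of two distances. -/
theorem ae_tsum_capture_zero (h : IsMarkedPoisson μ lam p (activeProb lamE D) X m)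
    (hlam : 0 < lam) (hlamE : 0 ≤ lamE) (hp0 : 0 < p) (hp1 : p ≤ 1) (hα : 2 < α)
    (hD : 0 < D) (ht : D ≤ t) :
    ∀ᵐ ω ∂μ, (activeIn X m D t).indicator 1 ω =
      ∑' e, (capture X m D α 0 t e).indicator (1 : Ω → ℝ≥0∞) ω := by
  have hmeas : Measurable fun ω => ∑' e, (capture X m D α 0 t e).indicator (1 : Ω → ℝ≥0∞) ω :=
    Measurable.tsum fun e => measurable_one.indicator (h.measurableSet_capture e)
  refine ae_eq_of_ae_le_of_lintegral_le ?_ ?_ hmeas.aemeasurable ?_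
  · filter_upwards [h.ae_pointCount_ne_top hlam.le hD.le ht] with ω hω
    by_cases hV : ω ∈ activeIn X m D t
    · obtain ⟨e, he⟩ := exists_isNearest hω hV
      refine le_trans ?_ (ENNReal.le_tsum e)
      rw [indicator_of_mem hV, indicator_of_mem (mem_capture_zero_iff.2 he)]
    · rw [indicator_of_notMem hV]; exact zero_le
  · rw [lintegral_indicator_one h.measurableSet_activeIn]; exact measure_ne_top _ _
  · rw [lintegral_tsum fun e =>
      (measurable_one.indicator (h.measurableSet_capture e)).aemeasurable,
      lintegral_indicator_one h.measurableSet_activeIn,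
      h.measure_activeIn hlam hlamE hp0 hp1 hD ht, ← h.tsum_capture_zero hlam hlamE hp0 hp1 hα hD ht]
    exact ENNReal.tsum_le_tsum fun e =>
      (lintegral_indicator_one (h.measurableSet_capture e)).le

theorem ae_exists_activeIn (h : IsMarkedPoisson μ lam p (activeProb lamE D) X m)
    (hlam : 0 < lam) (hlamE : 0 ≤ lamE) (hp0 : 0 < p) (hp1 : p ≤ 1) (hD : 0 < D) :
    ∀ᵐ ω ∂μ, ∃ k : ℕ, ω ∈ activeIn X m D (D + k) := by
  have hA := lamA_pos (lamE := lamE) (D := D) hlam hp0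
  have hle : ∀ k : ℕ, μ {ω | ¬ ∃ k : ℕ, ω ∈ activeIn X m D (D + k)} ≤
      ENNReal.ofReal (Real.exp (-(Real.pi * lamA lam lamE p D * ((D + k) ^ 2 - D ^ 2)))) := by
    intro k
    have hk : (0 : ℝ) ≤ (D + k) ^ 2 - D ^ 2 := by
      have : (0 : ℝ) ≤ k := k.cast_nonneg
      nlinarith
    have hsub : {ω | ¬ ∃ k : ℕ, ω ∈ activeIn X m D (D + k)} ⊆ (activeIn X m D (D + k))ᶜ := by
      rintro ω hω hk
      exact hω ⟨k, hk⟩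
    refine (measure_mono hsub).trans ?_
    rw [prob_compl_eq_one_sub h.measurableSet_activeIn, h.measure_activeIn hlam hlamE hp0 hp1 hD
      (by linarith [(k.cast_nonneg : (0 : ℝ) ≤ k)]), ← ENNReal.ofReal_one,
      ← ENNReal.ofReal_sub _ (sub_nonneg.2 (Real.exp_le_one_iff.2 (neg_nonpos.2 (by positivity))))]
    rw [sub_sub_cancel]
  have hlim : Tendsto (fun k : ℕ => ENNReal.ofReal
      (Real.exp (-(Real.pi * lamA lam lamE p D * ((D + k) ^ 2 - D ^ 2))))) atTop (𝓝 0) := by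
    rw [← ENNReal.ofReal_zero]
    refine (ENNReal.continuous_ofReal.tendsto 0).comp ?_
    refine Real.tendsto_exp_atBot.comp (tendsto_neg_atTop_atBot.comp ?_)
    refine Tendsto.const_mul_atTop (by positivity) ?_
    refine tendsto_atTop_add_const_right _ _ ?_
    exact (tendsto_pow_atTop two_ne_zero).comp
      (tendsto_atTop_add_const_left _ _ tendsto_natCast_atTop_atTop)
  exact le_antisymm (ge_of_tendsto' hlim hle) zero_le

theorem ae_existsUnique_isNearest (h : IsMarkedPoisson μ lam p (activeProb lamE D) X m)
    (hlam : 0 < lam) (hlamE : 0 ≤ lamE) (hp0 : 0 < p) (hp1 : p ≤ 1) (hD : 0 < D) :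
    ∀ᵐ ω ∂μ, ∃! e, IsNearest X m D ω e := by
  have hk : ∀ k : ℕ, D ≤ D + k := fun k => by linarith [(k.cast_nonneg : (0 : ℝ) ≤ k)]
  -- The choice `α = 3` is arbitrary: at `γ = 0` the capture event does not depend on `α`.
  filter_upwards [h.ae_exists_activeIn hlam hlamE hp0 hp1 hD,
    ae_all_iff.2 fun k : ℕ => h.ae_pointCount_ne_top hlam.le hD.le (hk k),
    ae_all_iff.2 fun k : ℕ =>
      h.ae_tsum_capture_zero (α := 3) hlam hlamE hp0 hp1 (by norm_num) hD (hk k)] with ω h1 h2 h3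
  obtain ⟨k, hV⟩ := h1
  obtain ⟨e, he, -⟩ := exists_isNearest (h2 k) hV
  refine ⟨e, he, fun e' he' => ?_⟩
  by_contra hne
  obtain ⟨j, hj⟩ := exists_nat_gt (max ‖X e ω‖ ‖X e' ω‖)
  have hle : ∀ i, IsNearest X m D ω i → ‖X i ω‖ ≤ max ‖X e ω‖ ‖X e' ω‖ →
      ω ∈ capture X m D 3 0 (D + j) i := fun i hi hi' =>
    mem_capture_zero_iff.2 ⟨hi, by linarith⟩
  have hsum : (2 : ℝ≥0∞) ≤
      ∑' e, (capture X m D 3 0 (D + j) e).indicator (1 : Ω → ℝ≥0∞) ω := by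
    refine le_trans ?_ (ENNReal.sum_le_tsum {e, e'})
    rw [Finset.sum_pair (Ne.symm hne), indicator_of_mem (hle e he (le_max_left _ _)),
      indicator_of_mem (hle e' he' (le_max_right _ _)), Pi.one_apply, one_add_one_eq_two]
  rw [← h3 j] at hsum
  have h4 := hsum.trans (indicator_le_self' (fun _ _ => zero_le) ω)
  simp at h4

theorem measure_isNearest_le (h : IsMarkedPoisson μ lam p (activeProb lamE D) X m)
    (hlam : 0 < lam) (hlamE : 0 ≤ lamE) (hp0 : 0 < p) (hp1 : p ≤ 1) (hD : 0 < D) (ht : D ≤ t) :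
    μ.real {ω | ∃ e, IsNearest X m D ω e ∧ ‖X e ω‖ ≤ t} =
      ∫ r in D..t, distPDF lam lamE p D r := by
  have hA := lamA_pos (lamE := lamE) (D := D) hlam hp0
  have hts : 0 ≤ t ^ 2 - D ^ 2 := by nlinarith
  have hae : {ω | ∃ e, IsNearest X m D ω e ∧ ‖X e ω‖ ≤ t} =ᵐ[μ] activeIn X m D t := by
    filter_upwards [h.ae_pointCount_ne_top hlam.le hD.le ht] with ω hω
    refine propext ⟨?_, fun hV => exists_isNearest hω hV⟩
    rintro ⟨e, he, het⟩
    exact ⟨e, he.1, he.2.1, het⟩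
  rw [measureReal_congr hae, measureReal_def, h.measure_activeIn hlam hlamE hp0 hp1 hD ht,
    ENNReal.toReal_ofReal (sub_nonneg.2 (Real.exp_le_one_iff.2 (neg_nonpos.2 (by positivity)))),
    integral_distPDF]

/-- The probability that the nearest active station is captured. -/
theorem measure_iUnion_capture (h : IsMarkedPoisson μ lam p (activeProb lamE D) X m)
    (hlam : 0 < lam) (hlamE : 0 ≤ lamE) (hp0 : 0 < p) (hp1 : p ≤ 1) (hα : 2 < α) (hγ : 0 < γ)
    (hD : 0 < D) :
    μ.real (⋃ k : ℕ, ⋃ e, capture X m D α γ (D + k) e) =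
      ∫ r in Ioi D, integrand lam lamE p D α γ (Theta lam lamE p D α γ r) r := by
  have hk : ∀ k : ℕ, D ≤ D + k := fun k => by linarith [(k.cast_nonneg : (0 : ℝ) ≤ k)]
  -- A captured station is nearest, and the nearest one is almost surely unique; so the sum of the
  -- capture probabilities is the probability of their union.
  have hdisj : ∀ k : ℕ, Pairwise (Function.onFun (AEDisjoint μ)
      fun e => capture X m D α γ (D + k) e) := by
    intro k i j hij
    refine measure_mono_null (t := {ω | ¬ ∃! e, IsNearest X m D ω e}) ?_
      (h.ae_existsUnique_isNearest hlam hlamE hp0 hp1 hD)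
    rintro ω ⟨hi, hj⟩ hu
    exact hij (hu.unique (isNearest_of_mem_capture hi) (isNearest_of_mem_capture hj))
  have h1 : ∀ k : ℕ, μ.real (⋃ e, capture X m D α γ (D + k) e) =
      ∫ r in D..(D + k), integrand lam lamE p D α γ (Theta lam lamE p D α γ r) r := by
    intro k
    rw [measureReal_def, measure_iUnion₀ (hdisj k) fun e =>
      (h.measurableSet_capture e).nullMeasurableSet]
    exact h.toReal_tsum_capture_eq hlam hlamE hp0 hp1 hα hγ hD (hk k)
  have hmono : Monotone fun k : ℕ => ⋃ e, capture X m D α γ (D + k) e := by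
    intro i j hij
    refine iUnion_mono fun e ω hω => ⟨⟨hω.1.1, hω.1.2.trans ?_⟩, hω.2⟩
    have : (i : ℝ) ≤ j := by exact_mod_cast hij
    linarith
  have hl := (ENNReal.tendsto_toReal (measure_ne_top μ _)).comp
    (tendsto_measure_iUnion_atTop (μ := μ) hmono)
  have hr := intervalIntegral_tendsto_integral_Ioi D
    (integrableOn_integrand_Theta (D := D) hlam hlamE hp0 hp1 hα hγ hD)
    (tendsto_atTop_add_const_left _ D tendsto_natCast_atTop_atTop)
  exact tendsto_nhds_unique hl (hr.congr fun k => (h1 k).symm)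

end IsMarkedPoisson

/-! ### From the network to capture events, and the theorem. -/

namespace Network

variable {Ω : Type*} [MeasurableSpace Ω] {μ : Measure Ω} {lam lamE p D : ℝ}
  (N : Network μ lam lamE p D) {P α γ t : ℝ} {ω : Ω} {e : ℕ}

/-- The mark of station `n`. -/
def mark (n : ℕ) (ω : Ω) : Mark := (N.cached n ω, N.clear n ω, N.fading n ω)

theorem mem_transmitters_diff_inDisk_iff {n : ℕ} :
    n ∈ N.transmitters ω \ N.inDisk ω ↔ N.mark n ω ∈ activeMarks ∧ D < ‖N.loc n ω‖ := by
  simp [transmitters, inDisk, activeMarks, mark]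

theorem isTarget_iff_isNearest (hD : 0 < D) (hP : 0 < P) (hα : 0 < α) :
    N.IsTarget P α ω e ↔ IsNearest N.loc N.mark D ω e := by
  have hle : ∀ m, D < ‖N.loc e ω‖ → D < ‖N.loc m ω‖ →
      (P * ‖N.loc m ω‖ ^ (-α) ≤ P * ‖N.loc e ω‖ ^ (-α) ↔ ‖N.loc e ω‖ ≤ ‖N.loc m ω‖) := by
    intro m h1 h2
    rw [mul_le_mul_iff_right₀ hP]
    exact Real.rpow_le_rpow_iff_of_neg (hD.trans h2) (hD.trans h1) (neg_neg_of_pos hα)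
  rw [IsTarget, mem_transmitters_diff_inDisk_iff, IsNearest, and_assoc]
  refine and_congr_right fun _ => and_congr_right fun hDe => ?_
  refine forall_congr' fun m => ?_
  rw [mem_transmitters_diff_inDisk_iff, and_imp]
  exact forall_congr' fun _ => forall_congr' fun hm => hle m hDe hm

/-- The three index sets partition all stations other than the target. -/
theorem interference_eq (he : e ∈ N.transmitters ω \ N.inDisk ω) :
    N.interference P α ω e = ∑' n, if n = e then 0 else N.power P α ω n := by
  rw [interference, tsum_subtype (N.others ω ∪ N.silenced ω) (N.power P α ω),
    tsum_subtype ((N.transmitters ω \ N.inDisk ω) \ {e}) (N.power P α ω),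
    tsum_subtype (N.transmitters ω ∩ N.inDisk ω) (N.power P α ω), ← ENNReal.tsum_add,
    ← ENNReal.tsum_add]
  refine tsum_congr fun n => ?_
  by_cases hn : n = e
  · subst hn
    have h1 : N.cached n ω = true := he.1.1
    have h2 : N.clear n ω = true := he.1.2
    have h3 : n ∉ N.inDisk ω := he.2
    simp [indicator, others, silenced, transmitters, h1, h2, h3]
  · by_cases hd : n ∈ N.inDisk ω <;> cases h1 : N.cached n ω <;> cases h2 : N.clear n ω <;>
      simp [indicator, others, silenced, transmitters, h1, h2, hd, hn]

/-- The eavesdropper decodes the target exactly when it is captured. -/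
theorem isTarget_and_not_lt_iff (hD : 0 < D) (hP : 0 < P) (hα : 0 < α) (hγ : 0 < γ)
    (hf : ∀ n, 0 < N.fading n ω) :
    (N.IsTarget P α ω e ∧ ‖N.loc e ω‖ ≤ t ∧
      ¬ N.power P α ω e / N.interference P α ω e < ENNReal.ofReal γ) ↔
      ω ∈ capture N.loc N.mark D α γ t e := by
  rw [mem_capture_iff, N.isTarget_iff_isNearest hD hP hα]
  refine and_congr_right fun hne => and_congr_right fun _ => ?_
  have hR : 0 < ‖N.loc e ω‖ := hD.trans hne.2.1
  set R := ‖N.loc e ω‖ with hRdef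
  have hRα : 0 < R ^ α := Real.rpow_pos_of_pos hR α
  have hpow : N.power P α ω e = ENNReal.ofReal (P * N.fading e ω * R ^ (-α)) := rfl
  have hpos : 0 < P * N.fading e ω * R ^ (-α) :=
    mul_pos (mul_pos hP (hf e)) (Real.rpow_pos_of_pos hR _)
  have hk0 : ENNReal.ofReal (R ^ α / P) ≠ 0 := by
    rw [Ne, ENNReal.ofReal_eq_zero, not_le]; positivity
  have hp0 : N.power P α ω e ≠ 0 := by
    rw [hpow, Ne, ENNReal.ofReal_eq_zero, not_le]; exact hpos
  have hpt : N.power P α ω e ≠ ⊤ := ENNReal.ofReal_ne_top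
  -- The signal is neither `0` nor `∞`, so clearing the denominator is valid even for zero or
  -- infinite interference. Scaling by `R^α / P` then isolates the fading of the target.
  rw [not_lt, ENNReal.le_div_iff_mul_le (Or.inr hp0) (Or.inr hpt),
    N.interference_eq (N.mem_transmitters_diff_inDisk_iff.2 ⟨hne.1, hne.2.1⟩),
    ← ENNReal.mul_le_mul_iff_right hk0 ENNReal.ofReal_ne_top, ← mul_assoc, ← ENNReal.tsum_mul_left]
  have h1 : ENNReal.ofReal (R ^ α / P) * N.power P α ω e = ENNReal.ofReal (N.mark e ω).2.2 := by
    rw [hpow, ← ENNReal.ofReal_mul (by positivity)]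
    congr 1
    rw [Real.rpow_neg hR.le, mark]
    field_simp
  have h2 : ∀ n, ENNReal.ofReal (R ^ α / P) * ENNReal.ofReal γ *
      (if n = e then 0 else N.power P α ω n) =
      if n = e then 0 else
        ENNReal.ofReal (γ * R ^ α * ‖N.loc n ω‖ ^ (-α) * (N.mark n ω).2.2) := by
    intro n
    split_ifs
    · rw [mul_zero]
    · rw [power, ← ENNReal.ofReal_mul (by positivity), ← ENNReal.ofReal_mul (by positivity)]
      congr 1
      rw [mark]
      field_simp
  rw [h1, tsum_congr h2]

/-- The marks of a network may be replaced by measurable ones. -/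
theorem exists_isMarkedPoisson [IsProbabilityMeasure μ] :
    ∃ m : ℕ → Ω → Mark, IsMarkedPoisson μ lam p (activeProb lamE D) N.loc m ∧
      ∀ᵐ ω ∂μ, ∀ n, m n ω = N.mark n ω := by
  -- A prescribed law only provides almost everywhere measurability of the marks.
  have hae : ∀ n, AEMeasurable (N.mark n) μ := fun n => (N.law_mark n).aemeasurable
  have heq : ∀ n, N.mark n =ᵐ[μ] (hae n).mk (N.mark n) := fun n => (hae n).ae_eq_mk
  have hall : ∀ᵐ ω ∂μ, ∀ n, (hae n).mk (N.mark n) ω = N.mark n ω := by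
    rw [ae_all_iff]
    exact fun n => (heq n).symm
  refine ⟨fun n => (hae n).mk (N.mark n), ⟨N.isPoisson, fun n => (hae n).measurable_mk, fun n => ?_, ?_, ?_⟩,
    hall⟩
  · rw [← Measure.map_congr (heq n)]
    exact (N.law_mark n).map_eq
  · exact N.indep_mark.congr heq
  · refine N.indep_loc_mark.congr (ae_of_all _ fun _ => rfl) ?_
    filter_upwards [hall] with ω hω
    funext n
    exact (hω n).symm

end Network

theorem IsMarkedPoisson.ae_fading_pos {Ω : Type*} [MeasurableSpace Ω] {μ : Measure Ω}
    {lam p a : ℝ} {X : ℕ → Ω → Plane} {m : ℕ → Ω → Mark} (h : IsMarkedPoisson μ lam p a X m) :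
    ∀ᵐ ω ∂μ, ∀ n, 0 < (m n ω).2.2 := by
  rw [ae_all_iff]
  intro n
  have hset : MeasurableSet {z : Mark | ¬ 0 < z.2.2} :=
    (measurableSet_lt measurable_const measurable_snd.snd).compl
  have h1 : {z : Mark | ¬ 0 < z.2.2} = univ ×ˢ (univ ×ˢ Iic (0 : ℝ)) := by
    ext z; simp
  have h0 : markLaw p a {z : Mark | ¬ 0 < z.2.2} = 0 := by
    rw [h1, markLaw, Measure.prod_prod, Measure.prod_prod, expMeasure_Iic le_rfl]
    simp
  rw [← h.map_mark n, Measure.map_apply (h.measurable_mark n) hset] at h0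
  exact h0

end CacheSecrecy

open CacheSecrecy

theorem theorem2 {Ω : Type*} [MeasurableSpace Ω] (μ : Measure Ω) [IsProbabilityMeasure μ]
    (lam lamE p D α P γ : ℝ) (hlam : 0 < lam) (hlamE : 0 ≤ lamE) (hp0 : 0 < p) (hp1 : p ≤ 1)
    (hD : 0 < D) (hα : 2 < α) (hP : 0 < P) (hγ : 0 < γ)
    (N : CacheSecrecy.Network μ lam lamE p D) :
    -- almost surely there is exactly one station that the eavesdropper listens to
    (∀ᵐ ω ∂μ, ∃! e, N.IsTarget P α ω e) ∧
    -- and its distance has the density `distPDF` on `r > D`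
    (∀ t, D ≤ t → μ.real {ω | ∃ e, N.IsTarget P α ω e ∧ ‖N.loc e ω‖ ≤ t} =
      ∫ r in D..t, CacheSecrecy.distPDF lam lamE p D r) ∧
    -- the exact formula
    (IntegrableOn (fun r => CacheSecrecy.integrand lam lamE p D α γ
        (CacheSecrecy.Theta lam lamE p D α γ r) r) (Set.Ioi D) ∧
      N.secrecyProb P α γ = 1 - ∫ r in Set.Ioi D, CacheSecrecy.integrand lam lamE p D α γ
        (CacheSecrecy.Theta lam lamE p D α γ r) r) ∧
    -- the value when `Θ(r)` is replaced by `Θ(D)`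
    (IntegrableOn (fun r => CacheSecrecy.integrand lam lamE p D α γ
        (CacheSecrecy.Theta lam lamE p D α γ D) r) (Set.Ioi D) ∧
      1 - ∫ r in Set.Ioi D, CacheSecrecy.integrand lam lamE p D α γ
        (CacheSecrecy.Theta lam lamE p D α γ D) r = CacheSecrecy.lowerBound lam lamE p D α γ) ∧
    -- the lower bound
    CacheSecrecy.lowerBound lam lamE p D α γ < N.secrecyProb P α γ := by
  have hα0 : 0 < α := by linarith
  obtain ⟨m, hm, hmark⟩ := N.exists_isMarkedPoisson
  have hnear : ∀ ω, (∀ n, m n ω = N.mark n ω) → ∀ e,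
      (N.IsTarget P α ω e ↔ IsNearest N.loc m D ω e) := by
    intro ω hω e
    rw [N.isTarget_iff_isNearest hD hP hα0]
    simp only [IsNearest, hω]
  have hcapture : ∀ ω, (∀ n, m n ω = N.mark n ω) → ∀ t e,
      (ω ∈ capture N.loc m D α γ t e ↔ ω ∈ capture N.loc N.mark D α γ t e) := by
    intro ω hω t e
    simp only [mem_capture_iff, IsNearest, hω]
  have hprob : N.secrecyProb P α γ = 1 - ∫ r in Set.Ioi D, integrand lam lamE p D α γ
        (Theta lam lamE p D α γ r) r := by
    have hmeas : MeasurableSet (⋃ k : ℕ, ⋃ e, capture N.loc m D α γ (D + k) e) :=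
      MeasurableSet.iUnion fun k => MeasurableSet.iUnion fun e => hm.measurableSet_capture e
    rw [← hm.measure_iUnion_capture hlam hlamE hp0 hp1 hα hγ hD, ← probReal_compl_eq_one_sub hmeas,
      Network.secrecyProb]
    refine measureReal_congr ?_
    -- Off a null set, secrecy is the complement of the union of the captures; the radii `D + k`
    -- exhaust all distances of the target.
    filter_upwards [hmark, hm.ae_fading_pos] with ω hω hpos
    have hf : ∀ n, 0 < N.fading n ω := fun n => by
      have := hpos n
      rwa [hω n] at this
    refine propext (Iff.trans ?_ (Set.mem_compl_iff _ _).symm)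
    simp only [Set.mem_iUnion, not_exists]
    constructor
    · intro h k e he
      have h2 := (N.isTarget_and_not_lt_iff hD hP hα0 hγ hf).2 ((hcapture ω hω _ e).1 he)
      exact h2.2.2 (h e h2.1)
    · intro h e he
      by_contra hlt
      obtain ⟨k, hk⟩ := exists_nat_gt ‖N.loc e ω‖
      exact h k e ((hcapture ω hω _ e).2 ((N.isTarget_and_not_lt_iff hD hP hα0 hγ hf).1
        ⟨he, by linarith, hlt⟩))
  have hlower := integral_integrand_Theta_self (lam := lam) (lamE := lamE) hlam hlamE hp0 hp1 hα hγ
    hD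
  refine ⟨?_, fun t ht => ?_, ⟨integrableOn_integrand_Theta hlam hlamE hp0 hp1 hα hγ hD, hprob⟩,
    ⟨integrableOn_integrand_const hlam hlamE hp0 hp1 hα hγ _, hlower⟩, ?_⟩
  · filter_upwards [hmark, hm.ae_existsUnique_isNearest hlam hlamE hp0 hp1 hD] with ω hω hu
    simpa only [hnear ω hω] using hu
  · rw [← hm.measure_isNearest_le hlam hlamE hp0 hp1 hD ht]
    refine measureReal_congr ?_
    filter_upwards [hmark] with ω hω
    refine propext (exists_congr fun e => and_congr_left fun _ => hnear ω hω e)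
  · rw [hprob, ← hlower]
    exact sub_lt_sub_left (integral_integrand_Theta_lt hlam hlamE hp0 hp1 hα hγ hD) 1
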